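/- **Theorem.** Let $\mathrm{MIX}=\{w\in\{a,b,c\}^* : |w|_a=|w|_b=|w|_c\}$, where $|w|_x$ is the number of occurrences of the letter $x$ in $w$. Then $\mathrm{MIX}$ is not generated by any $1$-displacement context-free grammar ($1$-DCFG). Hence $\mathrm{MIX}$ is neither a $2$-wMCFL (a language generated by a well-nested multiple context-free grammar all of whose nonterminals have dimension at most $2$) nor a tree-adjoining language (a language generated by a tree-adjoining grammar with adjunction, substitution and local adjoining constraints). Here a $k$-DCFG over a finite alphabet $\Sigma$ is defined as follows. Let $1\notin\Sigma$ be a separator; the rank of a word over $\Sigma\cup\{1\}$ is its number of separators, and for such words $u,v$ the intercalation $u\odot_j v$ is $u$ with its $j$-th separator replaced by $v$. Let $N$ be a finite set of nonterminals, each with a rank $\mathrm{rk}(A)\in\{0,\dots,k\}$. The $k$-correct terms and their ranks are given by: nonterminals $A$ (rank $\mathrm{rk}(A)$); words $w\in\Sigma^*$ (rank $0$); the separator $1$ (rank $1$); $\alpha\cdot\beta$ of rank $\mathrm{rk}(\alpha)+\mathrm{rk}(\beta)$, whenever this is at most $k$; and $\alpha\odot_j\beta$ of rank $\mathrm{rk}(\alpha)+\mathrm{rk}(\beta)-1$,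 whenever this is at most $k$, $1\le j\le k$ and $j\le\mathrm{rk}(\alpha)$. A $k$-DCFG consists of $N$, $\Sigma$, a start symbol $S\in N$ of rank $0$, and a finite set of rules $A\to\alpha$ with $A\in N$ and $\alpha$ a $k$-correct term with $\mathrm{rk}(\alpha)=\mathrm{rk}(A)$. A rule $B\to\beta$ rewrites one occurrence of $B$ in a term to $\beta$. The generated language consists of the values of all terms without nonterminals that are derivable from $S$ by finitely many rewriting steps, where $\cdot$ is evaluated as concatenation and $\odot_j$ as intercalation. -/

import Mathlib

/-! The MIX language. -/

/-- The three-letter alphabet `{a, b, c}`. -/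
inductive ABC : Type
  | a
  | b
  | c
  deriving DecidableEq

/-- The words over `{a, b, c}` with equally many `a`, `b` and `c`. -/
def MIX : Language ABC :=
  {w | w.count ABC.a = w.count ABC.b ∧ w.count ABC.b = w.count ABC.c}

/-! Displacement context-free grammars. Words over the alphabet `T` extended by the separator are
lists over `Option T`, where `none` is the separator; the rank of such a word is the number of
separators in it. -/

/-- The intercalation `u ⊙_j v`: the `j`-th separator of `u` (counted from `1`) is replaced
by `v`. -/
def intercalation {T : Type} : ℕ → List (Option T) → List (Option T) → List (Option T)
  | _, [], _ => []
  | j, some x :: u, v => some x :: intercalation j u v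
  | j, none :: u, v => if j = 1 then v ++ u else none :: intercalation (j - 1) u v

/-- Terms built from nonterminals, words over `T` and the separator by concatenation and the
intercalations `⊙_j`, before the rank restrictions. -/
inductive DTerm (N T : Type) : Type
  | nonterminal (A : N)
  | word (w : List T)
  | sep
  | concat (α β : DTerm N T)
  | inter (j : ℕ) (α β : DTerm N T)

namespace DTerm

variable {N T : Type}

/-- The rank of a term, given the ranks of the nonterminals. -/
def rank (rk : N → ℕ) : DTerm N T → ℕ
  | nonterminal A => rk A
  | word _ => 0
  | sep => 1
  | concat α β => rank rk α + rank rk β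
  | inter _ α β => rank rk α + rank rk β - 1

/-- The `k`-correct terms. -/
def Correct (rk : N → ℕ) (k : ℕ) : DTerm N T → Prop
  | nonterminal _ => True
  | word _ => True
  | sep => True
  | concat α β => Correct rk k α ∧ Correct rk k β ∧ rank rk α + rank rk β ≤ k
  | inter j α β => Correct rk k α ∧ Correct rk k β ∧ 1 ≤ j ∧ j ≤ k ∧ j ≤ rank rk α ∧
      rank rk α + rank rk β ≤ k + 1

/-- A term is ground if it contains no nonterminals. -/
def Ground : DTerm N T → Prop
  | nonterminal _ => False
  | word _ => True
  | sep => True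
  | concat α β => Ground α ∧ Ground β
  | inter _ α β => Ground α ∧ Ground β

/-- The value of a term under a valuation of the nonterminals. The value of a ground term does not
depend on the valuation. -/
def value (μ : N → List (Option T)) : DTerm N T → List (Option T)
  | nonterminal A => μ A
  | word w => w.map some
  | sep => [none]
  | concat α β => value μ α ++ value μ β
  | inter j α β => intercalation j (value μ α) (value μ β)

end DTerm

/-- A `k`-displacement context-free grammar over the alphabet `T`. -/
structure DCFG (k : ℕ) (T : Type) where
  /-- The nonterminals. -/
  N : Type
  finite_N : Finite N
  /-- The rank of a nonterminal. -/
  rk : N → ℕ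
  rk_le : ∀ A, rk A ≤ k
  /-- The start symbol. -/
  start : N
  rk_start : rk start = 0
  /-- The rules `A → α`, as pairs `(A, α)`. -/
  rules : Set (N × DTerm N T)
  finite_rules : rules.Finite
  correct_of_mem : ∀ A α, (A, α) ∈ rules → α.Correct rk k
  rank_of_mem : ∀ A α, (A, α) ∈ rules → α.rank rk = rk A

namespace DCFG

variable {k : ℕ} {T : Type}

/-- One derivation step: `C[B]` is rewritten to `C[β]`, where `B → β` is a rule and `C` is a
context with one hole. -/
inductive Step (G : DCFG k T) : DTerm G.N T → DTerm G.N T → Prop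
  | rule (B : G.N) (β : DTerm G.N T) (h : (B, β) ∈ G.rules) : Step G (.nonterminal B) β
  | concat_left (α α' β : DTerm G.N T) (h : Step G α α') :
      Step G (.concat α β) (.concat α' β)
  | concat_right (α β β' : DTerm G.N T) (h : Step G β β') :
      Step G (.concat α β) (.concat α β')
  | inter_left (j : ℕ) (α α' β : DTerm G.N T) (h : Step G α α') :
      Step G (.inter j α β) (.inter j α' β)
  | inter_right (j : ℕ) (α β β' : DTerm G.N T) (h : Step G β β') :
      Step G (.inter j α β) (.inter j α β')

/-- The relation `A ⊢ α`. -/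
def Derives (G : DCFG k T) (A : G.N) (α : DTerm G.N T) : Prop :=
  Relation.ReflTransGen G.Step (.nonterminal A) α

/-- The values of the ground terms derivable from `A`. -/
def wordsOf (G : DCFG k T) (A : G.N) : Set (List (Option T)) :=
  {u | ∃ α : DTerm G.N T, G.Derives A α ∧ α.Ground ∧ α.value (fun _ => []) = u}

/-- The language generated by the grammar. -/
def language (G : DCFG k T) : Language T :=
  {w | w.map some ∈ G.wordsOf G.start}

end DCFG

/-- `L` is generated by some `k`-displacement context-free grammar. -/
def IsDCFL (k : ℕ) {T : Type} (L : Language T) : Prop :=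
  ∃ G : DCFG k T, G.language = L

/-! Well-nested multiple context-free grammars. -/

/-- A rule `A(s_1, …, s_r) ← B_1(x_{1,1}, …, x_{1,d_1}), …, B_n(x_{n,1}, …, x_{n,d_n})`. The
components `s_1, …, s_r` are words over terminals and variables; the pair `(i, j)` stands for the
variable `x_{i,j}`, with `i` and `j` counted from `0`. -/
structure MCFRule (N T : Type) where
  /-- The nonterminal `A`. -/
  lhs : N
  /-- The number `n` of nonterminals on the right. -/
  arity : ℕ
  /-- The nonterminals `B_1, …, B_n`. -/
  rhs : Fin arity → N
  /-- The components `s_1, …, s_r`. -/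
  comps : List (List (T ⊕ (Fin arity × ℕ)))

namespace MCFRule

variable {N T : Type}

/-- The variables of `s_1 … s_r` in the order of their occurrence. -/
def vars (r : MCFRule N T) : List (Fin r.arity × ℕ) :=
  r.comps.flatten.filterMap Sum.getRight?

/-- The rule respects the dimensions, each variable of its right-hand side occurs exactly once in
the components, and no other variable occurs. -/
def WellFormed (dim : N → ℕ) (r : MCFRule N T) : Prop :=
  r.comps.length = dim r.lhs ∧ r.vars.Nodup ∧
    ∀ (i : Fin r.arity) (j : ℕ), (i, j) ∈ r.vars ↔ j < dim (r.rhs i)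

/-- Well-nestedness: `x_{i,j}` precedes `x_{i,j+1}` always, and the order
`x_{i,j}, x_{i',j'}, x_{i,j+1}, x_{i',j'+1}` with `i ≠ i'` never occurs. -/
def WellNested (dim : N → ℕ) (r : MCFRule N T) : Prop :=
  (∀ (i : Fin r.arity) (j : ℕ), j + 1 < dim (r.rhs i) →
      List.Sublist [(i, j), (i, j + 1)] r.vars) ∧
    ∀ (i i' : Fin r.arity) (j j' : ℕ), i ≠ i' →
      ¬ List.Sublist [(i, j), (i', j'), (i, j + 1), (i', j' + 1)] r.vars

/-- The word obtained from a component when the tuple `ws i` is substituted for the variables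
`x_{i,1}, …, x_{i,d_i}`. -/
def instantiate {n : ℕ} (ws : Fin n → List (List T)) (s : List (T ⊕ (Fin n × ℕ))) : List T :=
  s.flatMap fun
    | Sum.inl x => [x]
    | Sum.inr (i, j) => (ws i).getD j []

end MCFRule

/-- A well-nested multiple context-free grammar over the alphabet `T` in which every nonterminal
has dimension at most `k`. -/
structure WMCFG (k : ℕ) (T : Type) where
  /-- The nonterminals. -/
  N : Type
  finite_N : Finite N
  /-- The dimension of a nonterminal. -/
  dim : N → ℕ
  one_le_dim : ∀ A, 1 ≤ dim A
  dim_le : ∀ A, dim A ≤ k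
  /-- The start symbol. -/
  start : N
  dim_start : dim start = 1
  /-- The rules. -/
  rules : Set (MCFRule N T)
  finite_rules : rules.Finite
  wellFormed : ∀ r ∈ rules, r.WellFormed dim
  wellNested : ∀ r ∈ rules, r.WellNested dim

namespace WMCFG

variable {k : ℕ} {T : Type}

/-- The tuples of words derivable from a nonterminal. -/
inductive Derives (G : WMCFG k T) : G.N → List (List T) → Prop
  | rule (r : MCFRule G.N T) (hr : r ∈ G.rules) (ws : Fin r.arity → List (List T))
      (h : ∀ i, Derives G (r.rhs i) (ws i)) :
      Derives G r.lhs (r.comps.map (MCFRule.instantiate ws))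

/-- The language generated by the grammar. -/
def language (G : WMCFG k T) : Language T :=
  {w | G.Derives G.start [w]}

end WMCFG

/-- `L` is generated by some well-nested multiple context-free grammar of dimension at
most `k`. -/
def IsWMCFL (k : ℕ) {T : Type} (L : Language T) : Prop :=
  ∃ G : WMCFG k T, G.language = L

/-! Tree-adjoining grammars, with substitution and with local adjoining constraints. -/

/-- The adjoining constraint of a node: the auxiliary trees, named by `I`, that may be adjoined at
the node, and whether adjoining is obligatory. Null adjoining is the case `allowed = ∅`,
`obligatory = false`. -/
structure AdjConstraint (I : Type) where
  /-- The auxiliary trees that may be adjoined. -/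
  allowed : Set I
  /-- Whether adjoining is obligatory. -/
  obligatory : Bool

/-- Finite ordered trees over the nonterminals `N` and the terminals `T`. A leaf is labelled by a
terminal or by the empty word (`leaf none`), or it is a nonterminal marked for substitution, or a
foot node. -/
inductive TagTree (N T I : Type) : Type
  | leaf (x : Option T)
  | substNode (X : N)
  | foot (X : N) (C : AdjConstraint I)
  | node (X : N) (C : AdjConstraint I) (children : List (TagTree N T I))

namespace TagTree

variable {N T I : Type}

mutual
/-- The word formed by the terminals at the leaves. -/
def yield : TagTree N T I → List T
  | leaf x => x.toList
  | substNode _ => []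
  | foot _ _ => []
  | node _ _ ts => yieldList ts
/-- The concatenation of the yields of the trees of a list. -/
def yieldList : List (TagTree N T I) → List T
  | [] => []
  | t :: ts => yield t ++ yieldList ts
end

mutual
/-- The labels of the foot nodes, from left to right. -/
def feet : TagTree N T I → List N
  | leaf _ => []
  | substNode _ => []
  | foot X _ => [X]
  | node _ _ ts => feetList ts
/-- The labels of the foot nodes of the trees of a list. -/
def feetList : List (TagTree N T I) → List N
  | [] => []
  | t :: ts => feet t ++ feetList ts
end

mutual
/-- The tree with the subtrees `cs` attached below each foot node, which keeps its label and its
constraint and becomes an inner node. -/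
def plug (cs : List (TagTree N T I)) : TagTree N T I → TagTree N T I
  | leaf x => leaf x
  | substNode X => substNode X
  | foot X C => node X C cs
  | node X C ts => node X C (plugList cs ts)
/-- The operation `plug` on each tree of a list. -/
def plugList (cs : List (TagTree N T I)) : List (TagTree N T I) → List (TagTree N T I)
  | [] => []
  | t :: ts => plug cs t :: plugList cs ts
end

mutual
/-- Every inner node has at least one child. -/
def Proper : TagTree N T I → Prop
  | leaf _ => True
  | substNode _ => True
  | foot _ _ => True
  | node _ _ ts => ts ≠ [] ∧ ProperList ts
/-- Every tree of the list is proper. -/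
def ProperList : List (TagTree N T I) → Prop
  | [] => True
  | t :: ts => Proper t ∧ ProperList ts
end

mutual
/-- No substitution node, no foot node and no obligatory adjoining constraint is left. -/
def Complete : TagTree N T I → Prop
  | leaf _ => True
  | substNode _ => False
  | foot _ _ => False
  | node _ C ts => C.obligatory = false ∧ CompleteList ts
/-- Every tree of the list is complete. -/
def CompleteList : List (TagTree N T I) → Prop
  | [] => True
  | t :: ts => Complete t ∧ CompleteList ts
end

/-- The root is an inner node labelled by `X`. -/
def RootedAt (X : N) (t : TagTree N T I) : Prop :=
  ∃ (C : AdjConstraint I) (ts : List (TagTree N T I)), t = node X C ts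

end TagTree

/-- A tree-adjoining grammar over the alphabet `T`. -/
structure TAG (T : Type) where
  /-- The nonterminals. -/
  N : Type
  finite_N : Finite N
  /-- The start symbol. -/
  start : N
  /-- The names of the initial trees. -/
  Init : Type
  finite_Init : Finite Init
  /-- The names of the auxiliary trees. -/
  Aux : Type
  finite_Aux : Finite Aux
  /-- The initial trees. -/
  initTree : Init → TagTree N T Aux
  /-- The root labels of the initial trees. -/
  initLabel : Init → N
  init_proper : ∀ i, (initTree i).Proper
  init_root : ∀ i, (initTree i).RootedAt (initLabel i)
  init_feet : ∀ i, (initTree i).feet = []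
  /-- The auxiliary trees. -/
  auxTree : Aux → TagTree N T Aux
  /-- The common labels of the root and the foot node of the auxiliary trees. -/
  auxLabel : Aux → N
  aux_proper : ∀ b, (auxTree b).Proper
  aux_root : ∀ b, (auxTree b).RootedAt (auxLabel b)
  aux_feet : ∀ b, (auxTree b).feet = [auxLabel b]

namespace TAG

variable {T : Type}

/-- One derivation step: an auxiliary tree is adjoined at an inner node, or an initial tree is
substituted at a substitution node. -/
inductive Step (G : TAG T) : TagTree G.N T G.Aux → TagTree G.N T G.Aux → Prop
  | adjoin (C : AdjConstraint G.Aux) (ts : List (TagTree G.N T G.Aux)) (b : G.Aux)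
      (hb : b ∈ C.allowed) :
      Step G (.node (G.auxLabel b) C ts) ((G.auxTree b).plug ts)
  | substitute (i : G.Init) : Step G (.substNode (G.initLabel i)) (G.initTree i)
  | child (X : G.N) (C : AdjConstraint G.Aux) (l r : List (TagTree G.N T G.Aux))
      (t t' : TagTree G.N T G.Aux) (h : Step G t t') :
      Step G (.node X C (l ++ t :: r)) (.node X C (l ++ t' :: r))

/-- The language of the grammar: the yields of the complete trees derived from the initial trees
whose root is labelled by the start symbol. -/
def language (G : TAG T) : Language T :=
  {w | ∃ (i : G.Init) (t : TagTree G.N T G.Aux), G.initLabel i = G.start ∧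
    Relation.ReflTransGen G.Step (G.initTree i) t ∧ t.Complete ∧ t.yield = w}

end TAG

/-- `L` is a tree-adjoining language. -/
def IsTAL {T : Type} (L : Language T) : Prop :=
  ∃ G : TAG T, G.language = L

/-!
`MIX` is separated from displacement grammars of rank one by a single family of words, and the
other two formalisms reduce to these grammars.

Suppose that a `1`-DCFG generates `MIX`. Since all words of `MIX` contain the three letters equally
often, a subterm occurring in a derivation has values of only one excess (the differences of the
numbers of letters): exchanging one value for another in the derivation must lead to `MIX` again.
The rules contain finitely many subterms, so there is a bound `K` for these excesses, and every
word of `MIX` can be cut down by concatenation and wrapping to pieces of length at most `K`, where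
each piece on the way (a factor of the word, or a factor with a gap) contains the three letters
equally often up to `K` (`DCFG.Val.decomposable`).

For large `N` the word `a^N b^3N a^5N c^7N b^4N a^N` has no such decomposition
(`MixWord.not_decomposable`). A piece is described by two nested chords `(i, j) ⊇ (k, l)` of
positions. Read as a path in the plane with steps `a`, `b`, `c` of sum zero, the word is a closed
curve, and a piece is balanced if both chords have nearly the same displacement. The outer chord is
followed from the whole word inwards: while it starts in the first two blocks and ends in the last
two, it has lost some letters `a` first and then letters `b`, and the only chords with such
displacements are the short ones, those of the same kind, and those straddling the corner between
the block of `c` and the last block of `b`. Hence, if a piece has an outer chord of the first kind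
and an inner chord that is short or straddles the corner, then one of its two parts is again of this
form (`MixWord.outer_or_inner_of_balanced_split`). Such a piece contains the whole second block of
`a`, so that it is never small, which is absurd.

A tree-adjoining grammar is turned into a `1`-DCFG by giving rank `1` to what may be adjoined at a
node, and wrapping it around the children of the node (`TAG.language_toDCFG`). For a well-nested
rule with groups of at most two variables, a group is wrapped around the part between its variables
(`MCFRule.exists_term`, `WMCFG.language_toDCFG`).
-/

/-! ### A word without a balanced decomposition -/

namespace MixWord

/-- The word `a^N b^3N a^5N c^7N b^4N a^N`. -/
def word (N : ℕ) : List ABC :=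
  List.replicate N ABC.a ++ (List.replicate (3 * N) ABC.b ++ (List.replicate (5 * N) ABC.a ++
    (List.replicate (7 * N) ABC.c ++ (List.replicate (4 * N) ABC.b ++ List.replicate N ABC.a))))

/-- The number of letters `a` among the first `i` letters of `word N`. -/
def fa (N i : ℕ) : ℕ := min i N + (min (i - 4 * N) (5 * N) + min (i - 20 * N) N)

/-- The number of letters `b` among the first `i` letters of `word N`. -/
def fb (N i : ℕ) : ℕ := min (i - N) (3 * N) + min (i - 16 * N) (4 * N)

/-- The number of letters `c` among the first `i` letters of `word N`. -/
def fc (N i : ℕ) : ℕ := min (i - 9 * N) (7 * N)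

theorem length_word (N : ℕ) : (word N).length = 21 * N := by
  simp only [word, List.length_append, List.length_replicate]; omega

theorem count_prefix {N : ℕ} {x y : List ABC} (h : word N = x ++ y) :
    x.count ABC.a = fa N x.length ∧ x.count ABC.b = fb N x.length ∧
      x.count ABC.c = fc N x.length := by
  have hx : x = (word N).take x.length := by rw [h, List.take_left]
  generalize x.length = i at hx
  subst hx
  simp only [word, List.take_append, List.take_replicate, List.count_append, List.count_replicate,
    List.length_replicate, fa, fb, fc]
  simp
  omega

theorem word_mem_MIX (N : ℕ) : word N ∈ MIX := by
  have h := count_prefix (N := N) (x := word N) (y := []) (by simp)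
  rw [length_word] at h
  obtain ⟨h1, h2, h3⟩ := h
  refine ⟨?_, ?_⟩
  · rw [h1, h2, fa, fb]; omega
  · rw [h2, h3, fc, fb]; omega

/-- The position `i` lies in one of the six blocks, and there the counts are linear in `i`. -/
theorem block (N i : ℕ) (hi : i ≤ 21 * N) :
    (i ≤ N ∧ fa N i = i ∧ fb N i = 0 ∧ fc N i = 0) ∨
    (N ≤ i ∧ i ≤ 4 * N ∧ fa N i = N ∧ fb N i + N = i ∧ fc N i = 0) ∨
    (4 * N < i ∧ i < 9 * N ∧ fa N i + 3 * N = i ∧ fb N i = 3 * N ∧ fc N i = 0) ∨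
    (9 * N ≤ i ∧ i < 16 * N ∧ fa N i = 6 * N ∧ fb N i = 3 * N ∧ fc N i + 9 * N = i) ∨
    (16 * N ≤ i ∧ i ≤ 20 * N ∧ fa N i = 6 * N ∧ fb N i + 13 * N = i ∧ fc N i = 7 * N) ∨
    (20 * N < i ∧ fa N i + 14 * N = i ∧ fb N i = 7 * N ∧ fc N i = 7 * N) := by
  unfold fa fb fc
  by_cases h1 : i ≤ N
  · left; omega
  by_cases h2 : i ≤ 4 * N
  · right; left; omega
  by_cases h3 : i < 9 * N
  · right; right; left; omega
  by_cases h4 : i < 16 * N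
  · right; right; right; left; omega
  by_cases h5 : i ≤ 20 * N
  · right; right; right; right; left; omega
  · right; right; right; right; right; omega

theorem counts_start {N i : ℕ} (hi : i ≤ 4 * N) :
    fa N i + fb N i = i ∧ fc N i = 0 ∧ fa N i ≤ N ∧ (fb N i = 0 ∨ N ≤ i) ∧
      (i ≤ N ∨ fa N i = N) := by
  rcases block N i (by lia) with B | B | B | B | B | B <;> lia

theorem counts_second_a {N i : ℕ} (h1 : 4 * N < i) (h2 : i < 9 * N) :
    fa N i + 3 * N = i ∧ fb N i = 3 * N ∧ fc N i = 0 := by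
  rcases block N i (by lia) with B | B | B | B | B | B <;> lia

theorem counts_c {N i : ℕ} (h1 : 9 * N ≤ i) (h2 : i ≤ 16 * N) :
    fa N i = 6 * N ∧ fb N i = 3 * N ∧ fc N i + 9 * N = i := by
  rcases block N i (by lia) with B | B | B | B | B | B <;> lia

theorem counts_finish {N i : ℕ} (h1 : 16 * N ≤ i) (h2 : i ≤ 21 * N) :
    fa N i + fb N i + 7 * N = i ∧ fc N i = 7 * N ∧ 6 * N ≤ fa N i ∧ 3 * N ≤ fb N i ∧
      (fb N i = 7 * N ∨ i ≤ 20 * N) ∧ (20 * N < i ∨ fa N i = 6 * N) := by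
  rcases block N i (by lia) with B | B | B | B | B | B <;> lia

/-- The two intervals `[i, k)` and `[l, j)` of `word N` together contain the three letters equally
often, up to an error `K`. -/
def Balanced (N K i k l j : ℕ) : Prop :=
  fa N k + fa N j + fb N i + fb N l ≤ fb N k + fb N j + fa N i + fa N l + K ∧
  fb N k + fb N j + fa N i + fa N l ≤ fa N k + fa N j + fb N i + fb N l + K ∧
  fb N k + fb N j + fc N i + fc N l ≤ fc N k + fc N j + fb N i + fb N l + K ∧
  fc N k + fc N j + fb N i + fb N l ≤ fb N k + fb N j + fc N i + fc N l + K

/-- The chord `(i, j)` starts in the first two blocks of `word N` and ends in the last two. -/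
def Outer (N i j : ℕ) : Prop := i ≤ 4 * N ∧ 16 * N ≤ j

/-- The chord `(k, l)` straddles the boundary between the block of `c` and the last block of `b`,
or it is short. -/
def Inner (N K k l : ℕ) : Prop :=
  (9 * N ≤ k ∧ k ≤ 16 * N ∧ 16 * N ≤ l ∧ l ≤ 20 * N) ∨ l ≤ k + 10 * K

theorem outer_or_inner_of_balanced_interval {N K k l : ℕ} (hN : 100 * K < N) (hkl : k ≤ l)
    (hl : l ≤ 21 * N) (h : Balanced N K k l l l) : Outer N k l ∨ Inner N K k l := by
  unfold Balanced at h
  unfold Outer Inner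
  have hk := block N k (by lia)
  have hl' := block N l hl
  rcases hk with hk | hk | hk | hk | hk | hk <;>
    rcases hl' with hl' | hl' | hl' | hl' | hl' | hl' <;> lia

/-- If the inner chord is short and does not straddle the end of the block of `c`, then the outer
chord is nearly the whole word: the short chord contains no `b` or no `c`, whereas what the outer
chord has lost are letters `a`, followed by letters `b` only after `N` letters `a`. -/
theorem outer_large_of_short {N K i k l j : ℕ} (hN : 100 * K < N)
    (h3 : k ≤ l) (h5 : l ≤ j) (h6 : j ≤ 21 * N)
    (ho : Outer N i j) (hi : l ≤ k + 10 * K) (hb : Balanced N K i k l j)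
    (hs : k < 9 * N ∨ 16 * N ≤ k ∨ l < 16 * N) :
    i + 21 * N ≤ j + 2 * K ∧ i ≤ N := by
  obtain ⟨hb1, hb2, hb3, hb4⟩ := hb
  obtain ⟨ho1, ho2⟩ := ho
  have Bk := block N k (by lia)
  have Bl := block N l (by lia)
  have hi' := counts_start ho1
  have hj' := counts_finish ho2 h6
  have hs' : fa N k + fb N k + fc N k = k ∧ fa N l + fb N l + fc N l = l ∧
      fa N k ≤ fa N l ∧ fb N k ≤ fb N l ∧ fc N k ≤ fc N l ∧
      (fc N k = fc N l ∨ fb N k = fb N l) := by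
    rcases Bk with Bk | Bk | Bk | Bk | Bk | Bk <;>
      rcases Bl with Bl | Bl | Bl | Bl | Bl | Bl <;> lia
  clear Bk Bl
  lia

/-- A chord with the small displacement of a nearly whole chord is nearly the whole word, or short,
or it straddles the end of the block of `c`. -/
theorem outer_or_inner_of_nearly_whole {N K i k l j : ℕ} (hN : 100 * K < N)
    (h3 : k ≤ l) (h5 : l ≤ j) (h6 : j ≤ 21 * N)
    (h : i + 21 * N ≤ j + 2 * K) (hi : i ≤ N) (hb : Balanced N K i k l j) :
    Outer N k l ∨ Inner N K k l := by
  obtain ⟨hb1, hb2, hb3, hb4⟩ := hb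
  have hi' := counts_start (N := N) (i := i) (by lia)
  have hj' := counts_finish (by lia) h6
  -- the outer part is a few letters `a`
  have e : fa N i = i ∧ fb N i = 0 ∧ fc N i = 0 ∧ fa N j + 14 * N = j ∧ fb N j = 7 * N ∧
      fc N j = 7 * N := by lia
  clear hi' hj'
  unfold Outer Inner
  rcases block N k (by lia) with Bk | Bk | Bk | Bk | Bk | Bk <;>
    rcases block N l (by lia) with Bl | Bl | Bl | Bl | Bl | Bl <;> lia

/-- If the inner chord straddles the end of the block of `c`, then the outer chord has lost at
most `2 * N` letters `a`, and no more letters `b` than letters `a`, up to an error. A chord between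
the two with the same displacement can therefore contain neither the whole block of `c` nor the
whole last block of `b`, unless it starts in the first two blocks. -/
theorem outer_or_inner_of_straddling {N K i k l j k' l' : ℕ} (hN : 100 * K < N)
    (h2 : k' ≤ k) (h4 : l ≤ l') (h5 : l' ≤ j) (h6 : j ≤ 21 * N)
    (ho : Outer N i j) (hs : 9 * N ≤ k ∧ k ≤ 16 * N ∧ 16 * N ≤ l ∧ l ≤ 20 * N)
    (hb : Balanced N K i k l j) (hb' : Balanced N K i k' l' j) :
    Outer N k' l' ∨ Inner N K k' l' := by
  obtain ⟨hb1, hb2, hb3, hb4⟩ := hb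
  obtain ⟨hb1', hb2', hb3', hb4'⟩ := hb'
  obtain ⟨ho1, ho2⟩ := ho
  obtain ⟨hs1, hs2, hs3, hs4⟩ := hs
  obtain ⟨hi1, hi2, hi3, -, -⟩ := counts_start ho1
  obtain ⟨hj1, hj2, hj3, -, hj4, -⟩ := counts_finish ho2 h6
  obtain ⟨hk1, hk2, -⟩ := counts_c hs1 hs2
  obtain ⟨hl1, hl2, -, hl3, -, hl4⟩ := counts_finish hs3 (by lia)
  obtain ⟨hm1, hm2, -, hm3, hm4, -⟩ := counts_finish (hs3.trans h4) (h5.trans h6)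
  -- the outer chord has lost at most `2 * N` letters `b`, up to an error
  have hβ : fb N i + 7 * N ≤ 2 * N + 2 * K + fb N j := by lia
  clear hb1 hb2 hb3 hb4 hk1 hk2 hl1 hl2 hl3 hl4
  by_cases hk4 : k' ≤ 4 * N
  · exact .inl ⟨hk4, by lia⟩
  have hk9 : 9 * N ≤ k' := by
    by_contra hc
    have hk := counts_second_a (not_le.1 hk4) (not_le.1 hc)
    lia
  refine .inr (.inl ⟨hk9, by lia, by lia, ?_⟩)
  have hk := counts_c hk9 (by lia)
  rcases hm4 with hm4 | hm4
  · lia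
  · exact hm4

/-- Between an outer and an inner chord of a balanced piece, a chord with the same displacement is
again outer or inner. -/
theorem outer_or_inner_of_balanced_split {N K i k l j k' l' : ℕ} (hN : 100 * K < N)
    (h2 : k' ≤ k) (h3 : k ≤ l) (h4 : l ≤ l') (h5 : l' ≤ j) (h6 : j ≤ 21 * N)
    (ho : Outer N i j) (hi : Inner N K k l) (hb : Balanced N K i k l j)
    (hb' : Balanced N K i k' l' j) : Outer N k' l' ∨ Inner N K k' l' := by
  by_cases hs : 9 * N ≤ k ∧ k ≤ 16 * N ∧ 16 * N ≤ l ∧ l ≤ 20 * N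
  · exact outer_or_inner_of_straddling hN h2 h4 h5 h6 ho hs hb hb'
  · obtain ⟨g1, g2⟩ := outer_large_of_short hN h3 (h4.trans h5) h6 ho
      (hi.resolve_left hs) hb (by have := hi.resolve_left hs; lia)
    exact outer_or_inner_of_nearly_whole hN (h2.trans (h3.trans h4)) h5 h6 g1 g2 hb'

end MixWord

/-! ### Balanced decompositions -/

/-- The numbers of `a` and of `b`, and those of `b` and of `c`, differ by at most `K`. -/
def NearlyBalanced (K : ℕ) (w : List ABC) : Prop :=
  w.count ABC.a ≤ w.count ABC.b + K ∧ w.count ABC.b ≤ w.count ABC.a + K ∧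
    w.count ABC.b ≤ w.count ABC.c + K ∧ w.count ABC.c ≤ w.count ABC.b + K

/-- The pieces that arise when a word over `{a, b, c}` is cut up by concatenation and wrapping.
A piece is a word `(p, none)` or a pair of words `(p, some q)`. Every piece contains the three
letters equally often up to an error `K`, and the pieces that are not cut further have length at
most `K`. -/
inductive Decomposable (K : ℕ) : List ABC → Option (List ABC) → Prop
  | word (p : List ABC) (h : p.length ≤ K) : Decomposable K p none
  | sep : Decomposable K [] (some [])
  | concat (p q : List ABC) (hp : Decomposable K p none) (hq : Decomposable K q none)
      (h : NearlyBalanced K (p ++ q)) : Decomposable K (p ++ q) none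
  | concat_left (p q r : List ABC) (hp : Decomposable K p none) (hq : Decomposable K q (some r))
      (h : NearlyBalanced K (p ++ q ++ r)) : Decomposable K (p ++ q) (some r)
  | concat_right (p q r : List ABC) (hp : Decomposable K p (some q)) (hq : Decomposable K r none)
      (h : NearlyBalanced K (p ++ q ++ r)) : Decomposable K p (some (q ++ r))
  | wrap_word (p q r : List ABC) (hp : Decomposable K p (some q)) (hr : Decomposable K r none)
      (h : NearlyBalanced K (p ++ r ++ q)) : Decomposable K (p ++ r ++ q) none
  | wrap_pair (p q r s : List ABC) (hp : Decomposable K p (some q))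
      (hr : Decomposable K r (some s)) (h : NearlyBalanced K (p ++ r ++ s ++ q)) :
      Decomposable K (p ++ r) (some (s ++ q))

theorem Decomposable.nearlyBalanced {K : ℕ} {p : List ABC} {q : Option (List ABC)}
    (h : Decomposable K p q) : NearlyBalanced K (p ++ q.getD []) := by
  cases h with
  | word p h =>
    have h1 := List.count_le_length (a := ABC.a) (l := p)
    have h2 := List.count_le_length (a := ABC.b) (l := p)
    have h3 := List.count_le_length (a := ABC.c) (l := p)
    simp only [NearlyBalanced, Option.getD_none, List.append_nil]
    omega
  | sep => simp [NearlyBalanced]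
  | concat p q hp hq h => simpa using h
  | concat_left p q r hp hq h => simpa using h
  | concat_right p q r hp hq h => simpa using h
  | wrap_word p q r hp hr h => simpa using h
  | wrap_pair p q r s hp hr h => simpa using h

namespace MixWord

theorem balanced_of_nearlyBalanced {N K : ℕ} {x p y q z : List ABC}
    (hw : word N = x ++ p ++ y ++ q ++ z) (h : NearlyBalanced K (p ++ q)) :
    Balanced N K x.length (x ++ p).length (x ++ p ++ y).length (x ++ p ++ y ++ q).length := by
  have h1 := count_prefix (x := x) (y := p ++ y ++ q ++ z) (by simpa using hw)
  have h2 := count_prefix (x := x ++ p) (y := y ++ q ++ z) (by simpa using hw)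
  have h3 := count_prefix (x := x ++ p ++ y) (y := q ++ z) (by simpa using hw)
  have h4 := count_prefix (x := x ++ p ++ y ++ q) (y := z) (by simpa using hw)
  unfold Balanced
  rw [← h1.1, ← h1.2.1, ← h1.2.2, ← h2.1, ← h2.2.1, ← h2.2.2, ← h3.1, ← h3.2.1, ← h3.2.2,
    ← h4.1, ← h4.2.1, ← h4.2.2]
  unfold NearlyBalanced at h
  simp only [List.count_append] at h ⊢
  omega

theorem outer_or_inner_of_interval {N K : ℕ} (hN : 100 * K < N) {x p z : List ABC}
    (hw : word N = x ++ p ++ z) (h : Decomposable K p none) :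
    Outer N x.length (x ++ p).length ∨ Inner N K x.length (x ++ p).length := by
  have hb := balanced_of_nearlyBalanced (x := x) (p := p) (y := []) (q := []) (z := z)
    (by simpa using hw) (by simpa using h.nearlyBalanced)
  have hl := congrArg List.length hw
  rw [length_word] at hl
  simp only [List.append_nil, List.length_append] at hb hl ⊢
  exact outer_or_inner_of_balanced_interval hN (by omega) (by omega) hb

/-- No decomposable piece of `word N` has an outer chord that is `Outer` and, if it has a gap, an
inner chord that is `Inner`: when such a piece is cut in two, one of the parts is of the same kind,
but short pieces are not. -/
theorem not_decomposable_aux {N K : ℕ} (hN : 100 * K < N) {p : List ABC}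
    {o : Option (List ABC)} (h : Decomposable K p o) :
    (o = none → ∀ x z, word N = x ++ p ++ z → ¬ Outer N x.length (x ++ p).length) ∧
    ∀ q, o = some q → ∀ x y z, word N = x ++ p ++ y ++ q ++ z →
      Outer N x.length (x ++ p ++ y ++ q).length →
      ¬ Inner N K (x ++ p).length (x ++ p ++ y).length := by
  induction h with
  | word p h =>
    refine ⟨fun _ x z hw ho => ?_, fun q hq => by simp at hq⟩
    simp only [Outer, List.length_append] at ho
    omega
  | sep =>
    refine ⟨fun h => by simp at h, fun q hq x y z hw ho hi => ?_⟩
    obtain rfl : [] = q := by simpa using hq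
    simp only [Outer, Inner, List.append_nil, List.length_append] at ho hi
    omega
  | concat p q hp hq h ihp ihq =>
    refine ⟨fun _ x z hw ho => ?_, fun q hq => by simp at hq⟩
    have h1 := outer_or_inner_of_interval hN (x := x) (p := p) (z := q ++ z) (by simpa using hw) hp
    have h2 := outer_or_inner_of_interval hN (x := x ++ p) (p := q) (z := z) (by simpa using hw) hq
    have h3 := ihp.1 rfl x (q ++ z) (by simpa using hw)
    have h4 := ihq.1 rfl (x ++ p) z (by simpa using hw)
    replace h1 := h1.resolve_left h3
    replace h2 := h2.resolve_left h4
    simp only [Outer, Inner, List.length_append] at ho h1 h2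
    omega
  | concat_left p q r hp hq h ihp ihq =>
    refine ⟨fun h => by simp at h, fun r' hr x y z hw ho hi => ?_⟩
    obtain rfl : r = r' := by simpa using hr
    have hl := congrArg List.length hw
    rw [length_word] at hl
    have b1 := balanced_of_nearlyBalanced (x := x) (p := p ++ q) (y := y) (q := r) (z := z)
      hw (by simpa using h)
    have b2 := balanced_of_nearlyBalanced (x := x) (p := p) (y := q ++ y ++ r) (q := []) (z := z)
      (by simpa using hw) (by simpa using hp.nearlyBalanced)
    have h1 := outer_or_inner_of_interval hN (x := x) (p := p) (z := q ++ y ++ r ++ z)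
      (by simpa using hw) hp
    -- concatenation from the left is treated as wrapping by a pair with empty right component
    have h3 := ihp.1 rfl x (q ++ y ++ r ++ z) (by simpa using hw)
    have h4 := ihq.2 r rfl (x ++ p) y z (by simpa using hw)
    replace h1 := h1.resolve_left h3
    simp only [List.append_nil, List.length_append] at b1 b2 h1 h4 ho hi hl
    have h2 := outer_or_inner_of_balanced_split (k' := x.length + p.length)
      (l' := x.length + (p.length + q.length) + y.length + r.length) hN (by omega)
      (by omega) (by omega) le_rfl (by omega) ho hi b1 (by simpa [add_assoc] using b2)
    rcases h2 with h2 | h2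
    · exact h4 (by simpa [add_assoc] using h2) (by simpa [add_assoc] using hi)
    · simp only [Outer, Inner] at ho h1 h2
      omega
  | concat_right p q r hp hr h ihp ihr =>
    refine ⟨fun h => by simp at h, fun r' hr' x y z hw ho hi => ?_⟩
    obtain rfl : q ++ r = r' := by simpa using hr'
    have hl := congrArg List.length hw
    rw [length_word] at hl
    have b1 := balanced_of_nearlyBalanced (x := x) (p := p) (y := y) (q := q ++ r) (z := z)
      hw (by simpa using h)
    have b2 := balanced_of_nearlyBalanced (x := x) (p := []) (y := p ++ y ++ q) (q := r) (z := z)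
      (by simpa using hw) (by simpa using hr.nearlyBalanced)
    have h1 := outer_or_inner_of_interval hN (x := x ++ p ++ y ++ q) (p := r) (z := z)
      (by simpa using hw) hr
    have h3 := ihr.1 rfl (x ++ p ++ y ++ q) z (by simpa using hw)
    have h4 := ihp.2 q rfl x y (r ++ z) (by simpa using hw)
    replace h1 := h1.resolve_left h3
    simp only [List.append_nil, List.length_append] at b1 b2 h1 h4 ho hi hl
    have h2 := outer_or_inner_of_balanced_split (k' := x.length)
      (l' := x.length + p.length + y.length + q.length) hN (by omega)
      (by omega) (by omega) (by omega) (by omega) ho hi b1 (by simpa [add_assoc] using b2)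
    rcases h2 with h2 | h2
    · exact h4 (by simpa [add_assoc] using h2) (by simpa [add_assoc] using hi)
    · simp only [Outer, Inner] at ho h1 h2
      omega
  | wrap_word p q r hp hr h ihp ihr =>
    refine ⟨fun _ x z hw ho => ?_, fun q hq => by simp at hq⟩
    have h1 := outer_or_inner_of_interval hN (x := x ++ p) (p := r) (z := q ++ z)
      (by simpa using hw) hr
    have h3 := ihr.1 rfl (x ++ p) (q ++ z) (by simpa using hw)
    have h4 := ihp.2 q rfl x r z (by simpa using hw)
    exact h4 (by simpa using ho) (h1.resolve_left h3)
  | wrap_pair p q r s hp hr h ihp ihr =>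
    refine ⟨fun h => by simp at h, fun r' hr' x y z hw ho hi => ?_⟩
    obtain rfl : s ++ q = r' := by simpa using hr'
    have hl := congrArg List.length hw
    rw [length_word] at hl
    have b1 := balanced_of_nearlyBalanced (x := x) (p := p ++ r) (y := y) (q := s ++ q) (z := z)
      hw (by simpa using h)
    have b2 := balanced_of_nearlyBalanced (x := x) (p := p) (y := r ++ y ++ s) (q := q) (z := z)
      (by simpa using hw) (by simpa using hp.nearlyBalanced)
    have h3 := ihp.2 q rfl x (r ++ y ++ s) z (by simpa using hw)
    have h4 := ihr.2 s rfl (x ++ p) y (q ++ z) (by simpa using hw)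
    simp only [List.length_append] at b1 b2 h3 h4 ho hi hl
    have h2 := outer_or_inner_of_balanced_split (k' := x.length + p.length)
      (l' := x.length + p.length + (r.length + y.length + s.length)) hN (by omega)
      (by omega) (by omega) (by omega) (by omega) ho hi b1 (by simpa [add_assoc] using b2)
    rcases h2 with h2 | h2
    · exact h4 (by simpa [add_assoc] using h2) (by simpa [add_assoc] using hi)
    · exact h3 (by simpa [add_assoc] using ho) h2

theorem not_decomposable {N K : ℕ} (hN : 100 * K < N) : ¬ Decomposable K (word N) none := by
  intro h
  refine (not_decomposable_aux hN h).1 rfl [] [] (by simp) ?_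
  simp only [Outer, List.nil_append, List.length_nil, length_word]
  omega

end MixWord

/-! ### Words with separators -/

theorem exists_map_some {T : Type} {u : List (Option T)} (h : none ∉ u) :
    ∃ w : List T, u = w.map some := by
  induction u with
  | nil => exact ⟨[], rfl⟩
  | cons x u ih =>
    obtain ⟨w, rfl⟩ := ih (fun hn => h (List.mem_cons_of_mem _ hn))
    cases x with
    | none => simp at h
    | some x => exact ⟨x :: w, rfl⟩

/-- The number of separators in a word. -/
def sepCount {T : Type} (u : List (Option T)) : ℕ := u.countP Option.isNone

section

variable {T : Type}

@[simp] theorem sepCount_nil : sepCount ([] : List (Option T)) = 0 := rfl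

@[simp] theorem sepCount_cons_none (u : List (Option T)) :
    sepCount (none :: u) = sepCount u + 1 := by simp [sepCount]

@[simp] theorem sepCount_cons_some (x : T) (u : List (Option T)) :
    sepCount (some x :: u) = sepCount u := by simp [sepCount]

@[simp] theorem sepCount_append (u v : List (Option T)) :
    sepCount (u ++ v) = sepCount u + sepCount v := by simp [sepCount]

@[simp] theorem sepCount_map_some (w : List T) : sepCount (w.map some) = 0 := by
  simp [sepCount, List.countP_eq_zero]

theorem eq_map_some_of_sepCount_eq_zero {u : List (Option T)} (h : sepCount u = 0) :
    ∃ w : List T, u = w.map some := by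
  apply exists_map_some
  intro hn
  have := List.countP_eq_zero.1 h none hn
  simp at this

theorem eq_pair_of_sepCount_eq_one {u : List (Option T)} (h : sepCount u = 1) :
    ∃ p q : List T, u = p.map some ++ none :: q.map some := by
  induction u with
  | nil => simp at h
  | cons x u ih =>
    cases x with
    | none =>
      obtain ⟨q, rfl⟩ := eq_map_some_of_sepCount_eq_zero (u := u) (by simpa using h)
      exact ⟨[], q, rfl⟩
    | some x =>
      obtain ⟨p, q, rfl⟩ := ih (by simpa using h)
      exact ⟨x :: p, q, rfl⟩

@[simp] theorem intercalation_pair (p : List T) (q v : List (Option T)) :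
    intercalation 1 (p.map some ++ none :: q) v = p.map some ++ v ++ q := by
  induction p with
  | nil => simp [intercalation]
  | cons x p ih => simp [intercalation, ih]

theorem sepCount_intercalation {j : ℕ} {u v : List (Option T)} (h1 : 1 ≤ j)
    (h2 : j ≤ sepCount u) : sepCount (intercalation j u v) + 1 = sepCount u + sepCount v := by
  induction u generalizing j with
  | nil => simp at h2; omega
  | cons x u ih =>
    cases x with
    | none =>
      simp only [intercalation]
      split_ifs with hj
      · simp; omega
      · have := ih (j := j - 1) (by omega) (by simp at h2; omega)
        simp; omega
    | some x =>
      have := ih h1 (by simpa using h2)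
      simp [intercalation, this]

end

/-! ### Evaluation of terms -/

namespace DTerm

variable {N T : Type}

/-- The possible values of a term when each nonterminal `A` may take the values in `R A`,
independently at each of its occurrences. -/
def ValueIn (R : N → List (Option T) → Prop) : DTerm N T → List (Option T) → Prop
  | nonterminal A, u => R A u
  | word w, u => u = w.map some
  | sep, u => u = [none]
  | concat α β, u => ∃ v w, ValueIn R α v ∧ ValueIn R β w ∧ u = v ++ w
  | inter j α β, u => ∃ v w, ValueIn R α v ∧ ValueIn R β w ∧ u = intercalation j v w

theorem ValueIn.sepCount_eq {rk : N → ℕ} {k : ℕ} {R : N → List (Option T) → Prop}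
    (hR : ∀ A u, R A u → sepCount u = rk A) {α : DTerm N T} (hα : α.Correct rk k)
    {u : List (Option T)} (hu : α.ValueIn R u) : sepCount u = α.rank rk := by
  induction α generalizing u with
  | nonterminal A => exact hR A u hu
  | word w => rw [show u = w.map some from hu]; simp [rank]
  | sep => rw [show u = [none] from hu]; simp [rank]
  | concat α β ihα ihβ =>
    obtain ⟨v, w, hv, hw, rfl⟩ := hu
    simp [rank, ihα hα.1 hv, ihβ hα.2.1 hw]
  | inter j α β ihα ihβ =>
    obtain ⟨v, w, hv, hw, rfl⟩ := hu
    obtain ⟨h1, h2, h3, h4, h5, h6⟩ := hα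
    have := sepCount_intercalation (v := w) h3 (by rw [ihα h1 hv]; exact h5)
    rw [ihα h1 hv, ihβ h2 hw] at this
    simp only [rank]
    omega

end DTerm

namespace DCFG

variable {k : ℕ} {T : Type} (G : DCFG k T)

/-- Big-step derivations: `G.Val α u` says that some ground term derivable from `α` has the
value `u`. -/
inductive Val : DTerm G.N T → List (Option T) → Prop
  | nonterminal (A : G.N) (α : DTerm G.N T) (u : List (Option T)) (hr : (A, α) ∈ G.rules)
      (h : Val α u) : Val (.nonterminal A) u
  | word (w : List T) : Val (.word w) (w.map some)
  | sep : Val .sep [none]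
  | concat (α β : DTerm G.N T) (u v : List (Option T)) (hu : Val α u) (hv : Val β v) :
      Val (.concat α β) (u ++ v)
  | inter (j : ℕ) (α β : DTerm G.N T) (u v : List (Option T)) (hu : Val α u) (hv : Val β v) :
      Val (.inter j α β) (intercalation j u v)

variable {G}

theorem Val.of_ground {α : DTerm G.N T} (h : α.Ground) (μ : G.N → List (Option T)) :
    G.Val α (α.value μ) := by
  induction α with
  | nonterminal A => exact h.elim
  | word w => exact .word w
  | sep => exact .sep
  | concat α β ihα ihβ => exact .concat _ _ _ _ (ihα h.1) (ihβ h.2)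
  | inter j α β ihα ihβ => exact .inter _ _ _ _ _ (ihα h.1) (ihβ h.2)

theorem Val.of_step {α β : DTerm G.N T} (h : G.Step α β) {u : List (Option T)}
    (hu : G.Val β u) : G.Val α u := by
  induction h generalizing u with
  | rule B β h => exact .nonterminal _ _ _ h hu
  | concat_left α α' β h ih =>
    cases hu with
    | concat _ _ u v hu hv => exact .concat _ _ _ _ (ih hu) hv
  | concat_right α β β' h ih =>
    cases hu with
    | concat _ _ u v hu hv => exact .concat _ _ _ _ hu (ih hv)
  | inter_left j α α' β h ih =>
    cases hu with
    | inter _ _ _ u v hu hv => exact .inter _ _ _ _ _ (ih hu) hv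
  | inter_right j α β β' h ih =>
    cases hu with
    | inter _ _ _ u v hu hv => exact .inter _ _ _ _ _ hu (ih hv)

theorem val_iff {α : DTerm G.N T} {u : List (Option T)} : G.Val α u ↔
    ∃ β, Relation.ReflTransGen G.Step α β ∧ β.Ground ∧ β.value (fun _ => []) = u := by
  constructor
  · intro h
    induction h with
    | nonterminal A α u hr h ih =>
      obtain ⟨β, h1, h2, h3⟩ := ih
      exact ⟨β, .head (.rule A α hr) h1, h2, h3⟩
    | word w => exact ⟨.word w, .refl, trivial, rfl⟩
    | sep => exact ⟨.sep, .refl, trivial, rfl⟩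
    | concat α β u v hu hv ihu ihv =>
      obtain ⟨α', h1, h2, h3⟩ := ihu
      obtain ⟨β', h1', h2', h3'⟩ := ihv
      refine ⟨.concat α' β', ?_, ⟨h2, h2'⟩, by rw [DTerm.value, h3, h3']⟩
      have e1 : Relation.ReflTransGen G.Step (.concat α β) (.concat α' β) :=
        Relation.ReflTransGen.lift (p := G.Step) (fun γ => DTerm.concat γ β)
          (fun _ _ h => Step.concat_left _ _ _ h) _ _ h1
      have e2 : Relation.ReflTransGen G.Step (.concat α' β) (.concat α' β') :=
        Relation.ReflTransGen.lift (p := G.Step) (fun γ => DTerm.concat α' γ)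
          (fun _ _ h => Step.concat_right _ _ _ h) _ _ h1'
      exact e1.trans e2
    | inter j α β u v hu hv ihu ihv =>
      obtain ⟨α', h1, h2, h3⟩ := ihu
      obtain ⟨β', h1', h2', h3'⟩ := ihv
      refine ⟨.inter j α' β', ?_, ⟨h2, h2'⟩, by rw [DTerm.value, h3, h3']⟩
      have e1 : Relation.ReflTransGen G.Step (.inter j α β) (.inter j α' β) :=
        Relation.ReflTransGen.lift (p := G.Step) (fun γ => DTerm.inter j γ β)
          (fun _ _ h => Step.inter_left _ _ _ _ h) _ _ h1
      have e2 : Relation.ReflTransGen G.Step (.inter j α' β) (.inter j α' β') :=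
        Relation.ReflTransGen.lift (p := G.Step) (fun γ => DTerm.inter j α' γ)
          (fun _ _ h => Step.inter_right _ _ _ _ h) _ _ h1'
      exact e1.trans e2
  · rintro ⟨β, h, hg, rfl⟩
    induction h using Relation.ReflTransGen.head_induction_on with
    | refl => exact .of_ground hg _
    | head h _ ih => exact .of_step h ih

theorem mem_language {w : List T} :
    w ∈ G.language ↔ G.Val (.nonterminal G.start) (w.map some) := by
  rw [val_iff]; rfl

theorem Val.exists_of_concat {α β : DTerm G.N T} {u : List (Option T)}
    (h : G.Val (.concat α β) u) : ∃ v w, G.Val α v ∧ G.Val β w ∧ u = v ++ w := by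
  cases h with
  | concat _ _ v w hv hw => exact ⟨v, w, hv, hw, rfl⟩

theorem Val.exists_of_inter {j : ℕ} {α β : DTerm G.N T} {u : List (Option T)}
    (h : G.Val (.inter j α β) u) : ∃ v w, G.Val α v ∧ G.Val β w ∧ u = intercalation j v w := by
  cases h with
  | inter _ _ _ v w hv hw => exact ⟨v, w, hv, hw, rfl⟩

theorem Val.of_valueIn {R : G.N → List (Option T) → Prop}
    (hR : ∀ A u, R A u → G.Val (.nonterminal A) u) {α : DTerm G.N T} {u : List (Option T)}
    (h : α.ValueIn R u) : G.Val α u := by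
  induction α generalizing u with
  | nonterminal A => exact hR A u h
  | word w => rw [show u = w.map some from h]; exact .word w
  | sep => rw [show u = [none] from h]; exact .sep
  | concat α β ihα ihβ =>
    obtain ⟨v, w, hv, hw, rfl⟩ := h
    exact .concat _ _ _ _ (ihα hv) (ihβ hw)
  | inter j α β ihα ihβ =>
    obtain ⟨v, w, hv, hw, rfl⟩ := h
    exact .inter _ _ _ _ _ (ihα hv) (ihβ hw)

/-- The derivable values are the least family of sets closed under the rules. -/
theorem Val.valueIn {R : G.N → List (Option T) → Prop}
    (hR : ∀ A α u, (A, α) ∈ G.rules → α.ValueIn R u → R A u) {α : DTerm G.N T}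
    {u : List (Option T)} (h : G.Val α u) : α.ValueIn R u := by
  induction h with
  | nonterminal A α u hr h ih => exact hR A α u hr ih
  | word w => rfl
  | sep => rfl
  | concat α β u v hu hv ihu ihv => exact ⟨u, v, ihu, ihv, rfl⟩
  | inter j α β u v hu hv ihu ihv => exact ⟨u, v, ihu, ihv, rfl⟩

theorem Val.sepCount_eq {α : DTerm G.N T} (hα : α.Correct G.rk k) {u : List (Option T)}
    (h : G.Val α u) : sepCount u = α.rank G.rk := by
  refine DTerm.ValueIn.sepCount_eq (R := fun A u => sepCount u = G.rk A)
    (fun _ _ h => h) hα (h.valueIn fun A α u hr hu => ?_)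
  rw [← G.rank_of_mem A α hr]
  exact hu.sepCount_eq (fun _ _ h => h) (G.correct_of_mem A α hr)

end DCFG

/-! ### Derivations in a grammar for `MIX` -/

/-- The differences of the numbers of `a` and `b`, and of `b` and `c`. -/
def excess (u : List (Option ABC)) : ℤ × ℤ :=
  ((u.count (some ABC.a) : ℤ) - u.count (some ABC.b),
    (u.count (some ABC.b) : ℤ) - u.count (some ABC.c))

theorem excess_append (u v : List (Option ABC)) : excess (u ++ v) = excess u + excess v := by
  simp only [excess, List.count_append, Prod.mk_add_mk]
  push_cast
  ext <;> ring

theorem excess_cons (x : Option ABC) (u : List (Option ABC)) :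
    excess (x :: u) = excess [x] + excess u := by
  rw [← excess_append]; rfl

theorem excess_none : excess [none] = 0 := rfl

theorem excess_intercalation {j : ℕ} {u v : List (Option ABC)} (h1 : 1 ≤ j)
    (h2 : j ≤ sepCount u) : excess (intercalation j u v) = excess u + excess v := by
  induction u generalizing j with
  | nil => simp at h2; omega
  | cons x u ih =>
    cases x with
    | none =>
      simp only [intercalation]
      split_ifs with hj
      · rw [excess_append, excess_cons none u, excess_none, zero_add, add_comm]
      · have := ih (j := j - 1) (by omega) (by simp at h2; omega)
        rw [excess_cons none, this, excess_cons none u, add_assoc]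
    | some x =>
      have := ih h1 (by simpa using h2)
      rw [intercalation, excess_cons (some x), this, excess_cons (some x) u, add_assoc]

/-- The word over `{a, b, c, 1}` encoding a word `p` or a pair of words `(p, q)`. -/
def encodePiece (p : List ABC) : Option (List ABC) → List (Option ABC)
  | none => p.map some
  | some q => p.map some ++ none :: q.map some

theorem count_encodePiece (x : ABC) (p : List ABC) (o : Option (List ABC)) :
    (encodePiece p o).count (some x) = (p ++ o.getD []).count x := by
  have h (w : List ABC) : (w.map some).count (some x) = w.count x :=
    List.count_map_of_injective _ _ (Option.some_injective _) _
  cases o <;> simp [encodePiece, h]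

theorem sepCount_encodePiece (p : List ABC) (o : Option (List ABC)) :
    sepCount (encodePiece p o) = if o.isSome then 1 else 0 := by
  cases o <;> simp [encodePiece]

namespace DCFG

variable (G : DCFG 1 ABC)

/-- All values of the term have the same excess. -/
def Rigid (α : DTerm G.N ABC) : Prop := ∃ d, ∀ u, G.Val α u → excess u = d

/-- If all values of the term have the same excess, then it is at most `K`. -/
def ExcessAtMost (K : ℕ) (α : DTerm G.N ABC) : Prop :=
  G.Rigid α → ∀ u, G.Val α u → |(excess u).1| ≤ K ∧ |(excess u).2| ≤ K

/-- The words in the term have length at most `K`, and each compound subterm whose values all have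
the same excess has excess at most `K`. -/
def BoundedBy (K : ℕ) : DTerm G.N ABC → Prop
  | .nonterminal _ => True
  | .word w => w.length ≤ K
  | .sep => True
  | .concat α β => G.ExcessAtMost K (.concat α β) ∧ BoundedBy K α ∧ BoundedBy K β
  | .inter j α β => G.ExcessAtMost K (.inter j α β) ∧ BoundedBy K α ∧ BoundedBy K β

variable {G}

theorem ExcessAtMost.mono {K K' : ℕ} (h : K ≤ K') {α : DTerm G.N ABC}
    (hα : G.ExcessAtMost K α) : G.ExcessAtMost K' α := fun hr u hu =>
  have hK : (K : ℤ) ≤ K' := by exact_mod_cast h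
  ⟨(hα hr u hu).1.trans hK, (hα hr u hu).2.trans hK⟩

theorem exists_excessAtMost (α : DTerm G.N ABC) : ∃ K, G.ExcessAtMost K α := by
  by_cases hr : G.Rigid α
  · obtain ⟨d, hd⟩ := hr
    refine ⟨max d.1.natAbs d.2.natAbs, fun _ u hu => ?_⟩
    rw [hd u hu]
    push_cast
    simp
  · exact ⟨0, fun h => absurd h hr⟩

theorem BoundedBy.mono {K K' : ℕ} (h : K ≤ K') {α : DTerm G.N ABC}
    (hα : G.BoundedBy K α) : G.BoundedBy K' α := by
  induction α with
  | nonterminal A => trivial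
  | word w => exact le_trans (show w.length ≤ K from hα) h
  | sep => trivial
  | concat α β ihα ihβ => exact ⟨hα.1.mono h, ihα hα.2.1, ihβ hα.2.2⟩
  | inter j α β ihα ihβ => exact ⟨hα.1.mono h, ihα hα.2.1, ihβ hα.2.2⟩

theorem exists_boundedBy (α : DTerm G.N ABC) : ∃ K, G.BoundedBy K α := by
  induction α with
  | nonterminal A => exact ⟨0, trivial⟩
  | word w => exact ⟨w.length, le_rfl⟩
  | sep => exact ⟨0, trivial⟩
  | concat α β ihα ihβ =>
    obtain ⟨K₁, h₁⟩ := ihα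
    obtain ⟨K₂, h₂⟩ := ihβ
    obtain ⟨K₃, h₃⟩ := exists_excessAtMost (.concat α β)
    exact ⟨max K₁ (max K₂ K₃), h₃.mono (by simp), h₁.mono (by simp), h₂.mono (by simp)⟩
  | inter j α β ihα ihβ =>
    obtain ⟨K₁, h₁⟩ := ihα
    obtain ⟨K₂, h₂⟩ := ihβ
    obtain ⟨K₃, h₃⟩ := exists_excessAtMost (.inter j α β)
    exact ⟨max K₁ (max K₂ K₃), h₃.mono (by simp), h₁.mono (by simp), h₂.mono (by simp)⟩

variable (G) in
theorem exists_boundedBy_rules : ∃ K, ∀ A α, (A, α) ∈ G.rules → G.BoundedBy K α := by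
  choose f hf using exists_boundedBy (G := G)
  obtain ⟨K, hK⟩ := (G.finite_rules.image fun r => f r.2).bddAbove
  exact ⟨K, fun A α h => (hf α).mono (hK ⟨(A, α), h, rfl⟩)⟩

theorem nearlyBalanced_of_excessAtMost {K : ℕ} {α : DTerm G.N ABC} (h : G.ExcessAtMost K α)
    (hr : G.Rigid α) {p : List ABC} {o : Option (List ABC)} (hu : G.Val α (encodePiece p o)) :
    NearlyBalanced K (p ++ o.getD []) := by
  have := h hr _ hu
  simp only [excess, count_encodePiece, abs_le] at this
  unfold NearlyBalanced
  omega

/-- Every value occurring in a derivation of a word of the language is decomposable. The hypothesis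
that all values of the term have the same excess passes to the immediate subterms, since the
values of their siblings may be kept fixed. -/
theorem Val.decomposable {K : ℕ} (hK : ∀ A α, (A, α) ∈ G.rules → G.BoundedBy K α)
    {α : DTerm G.N ABC} {u : List (Option ABC)} (h : G.Val α u) (hc : α.Correct G.rk 1)
    (hr : G.Rigid α) (hb : G.BoundedBy K α) :
    ∃ p o, u = encodePiece p o ∧ Decomposable K p o := by
  induction h with
  | nonterminal A α u hA h ih =>
    refine ih (G.correct_of_mem A α hA) ?_ (hK A α hA)
    obtain ⟨d, hd⟩ := hr
    exact ⟨d, fun v hv => hd v (.nonterminal A α v hA hv)⟩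
  | word w => exact ⟨w, none, rfl, .word w hb⟩
  | sep => exact ⟨[], some [], rfl, .sep⟩
  | concat α β u v hu hv ihu ihv =>
    obtain ⟨hcα, hcβ, hrank⟩ := id hc
    obtain ⟨d, hd⟩ := id hr
    have su := hu.sepCount_eq hcα
    have sv := hv.sepCount_eq hcβ
    obtain ⟨p, o, rfl, hp⟩ := ihu hcα ⟨d - excess v, fun u' hu' => by
      rw [← hd _ (.concat _ _ _ _ hu' hv), excess_append, add_sub_cancel_right]⟩ hb.2.1
    obtain ⟨q, o', rfl, hq⟩ := ihv hcβ ⟨d - excess (encodePiece p o), fun v' hv' => by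
      rw [← hd _ (.concat _ _ _ _ hu hv'), excess_append, add_sub_cancel_left]⟩ hb.2.2
    rw [sepCount_encodePiece] at su sv
    have hbal (p' : List ABC) (o'' : Option (List ABC))
        (e : encodePiece p o ++ encodePiece q o' = encodePiece p' o'') :
        NearlyBalanced K (p' ++ o''.getD []) :=
      nearlyBalanced_of_excessAtMost hb.1 hr (e ▸ .concat _ _ _ _ hu hv)
    cases o with
    | none =>
      cases o' with
      | none =>
        have e : encodePiece p none ++ encodePiece q none = encodePiece (p ++ q) none := by
          simp [encodePiece]
        exact ⟨p ++ q, none, e, .concat _ _ hp hq (by simpa using hbal _ _ e)⟩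
      | some r =>
        have e : encodePiece p none ++ encodePiece q (some r) =
            encodePiece (p ++ q) (some r) := by simp [encodePiece]
        exact ⟨p ++ q, some r, e, .concat_left _ _ _ hp hq (by simpa using hbal _ _ e)⟩
    | some r =>
      cases o' with
      | none =>
        have e : encodePiece p (some r) ++ encodePiece q none =
            encodePiece p (some (r ++ q)) := by simp [encodePiece]
        exact ⟨p, some (r ++ q), e, .concat_right _ _ _ hp hq (by simpa using hbal _ _ e)⟩
      | some r' =>
        simp at su sv
        omega
  | inter j α β u v hu hv ihu ihv =>
    obtain ⟨hcα, hcβ, hj1, hj2, hj3, hrank⟩ := id hc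
    obtain ⟨d, hd⟩ := id hr
    have su := hu.sepCount_eq hcα
    obtain rfl : j = 1 := by omega
    obtain ⟨p, o, rfl, hp⟩ := ihu hcα ⟨d - excess v, fun u' hu' => by
      rw [← hd _ (.inter _ _ _ _ _ hu' hv), excess_intercalation hj1
        (by rwa [hu'.sepCount_eq hcα]), add_sub_cancel_right]⟩ hb.2.1
    obtain ⟨q, o', rfl, hq⟩ := ihv hcβ ⟨d - excess (encodePiece p o), fun v' hv' => by
      rw [← hd _ (.inter _ _ _ _ _ hu hv'), excess_intercalation hj1
        (by rwa [su]), add_sub_cancel_left]⟩ hb.2.2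
    rw [sepCount_encodePiece] at su
    have hbal (p' : List ABC) (o'' : Option (List ABC))
        (e : intercalation 1 (encodePiece p o) (encodePiece q o') = encodePiece p' o'') :
        NearlyBalanced K (p' ++ o''.getD []) :=
      nearlyBalanced_of_excessAtMost hb.1 hr (e ▸ .inter _ _ _ _ _ hu hv)
    cases o with
    | none => simp at su; omega
    | some r =>
      cases o' with
      | none =>
        have e : intercalation 1 (encodePiece p (some r)) (encodePiece q none) =
            encodePiece (p ++ q ++ r) none := by simp [encodePiece]
        exact ⟨_, _, e, .wrap_word _ _ _ hp hq (by simpa using hbal _ _ e)⟩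
      | some s =>
        have e : intercalation 1 (encodePiece p (some r)) (encodePiece q (some s)) =
            encodePiece (p ++ q) (some (s ++ r)) := by simp [encodePiece]
        exact ⟨_, _, e, .wrap_pair _ _ _ _ hp hq (by simpa using hbal _ _ e)⟩

end DCFG

theorem not_isDCFL_MIX : ¬ IsDCFL 1 MIX := by
  rintro ⟨G, hG⟩
  obtain ⟨K, hK⟩ := G.exists_boundedBy_rules
  have hw : G.Val (.nonterminal G.start) ((MixWord.word (100 * K + 1)).map some) := by
    rw [← DCFG.mem_language, hG]
    exact MixWord.word_mem_MIX _
  have hr : G.Rigid (.nonterminal G.start) := by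
    refine ⟨0, fun u hu => ?_⟩
    obtain ⟨w, rfl⟩ := eq_map_some_of_sepCount_eq_zero
      ((hu.sepCount_eq (α := .nonterminal G.start) trivial).trans G.rk_start)
    have hm : w ∈ MIX := by rw [← hG, DCFG.mem_language]; exact hu
    have hc (x : ABC) := count_encodePiece x w none
    simp only [encodePiece, Option.getD_none, List.append_nil] at hc
    rw [excess, hc, hc, hc, hm.1, hm.2]
    simp
  obtain ⟨p, o, e, hp⟩ := hw.decomposable hK trivial hr trivial
  have ho : o = none := by
    have := congrArg sepCount e
    rw [sepCount_map_some, sepCount_encodePiece] at this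
    cases o with
    | none => rfl
    | some q => simp at this
  subst ho
  obtain rfl := (List.map_injective_iff.2 (Option.some_injective _)) e
  exact MixWord.not_decomposable (by omega) hp

/-! ### From tree-adjoining grammars to displacement grammars -/

/-- The word with every separator replaced by `v`. -/
def fill {T : Type} (v : List T) (u : List (Option T)) : List T :=
  u.flatMap fun x => x.elim v fun x => [x]

section

variable {T : Type}

@[simp] theorem fill_append (v : List T) (u u' : List (Option T)) :
    fill v (u ++ u') = fill v u ++ fill v u' := by simp [fill]

@[simp] theorem fill_cons_none (v : List T) (u : List (Option T)) :
    fill v (none :: u) = v ++ fill v u := by simp [fill]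

@[simp] theorem fill_map_some (v w : List T) : fill v (w.map some) = w := by
  induction w with
  | nil => rfl
  | cons x w ih => simpa [fill] using ih

end

namespace TAG

open TagTree

variable {T : Type}

mutual
/-- The term describing what is derivable from a tree. At an inner node a nonterminal for
what may be adjoined there wraps the term of the children; at a foot node the same nonterminal
stands alone, since the subtrees below the foot take the place of its separator. -/
def term {N I : Type} : TagTree N T I → DTerm (N ⊕ N × AdjConstraint I) T
  | .leaf x => .word x.toList
  | .substNode X => .nonterminal (.inl X)
  | .foot X C => .nonterminal (.inr (X, C))
  | .node X C ts => .inter 1 (.nonterminal (.inr (X, C))) (termList ts)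
/-- The concatenation of the terms of the trees of a list. -/
def termList {N I : Type} : List (TagTree N T I) → DTerm (N ⊕ N × AdjConstraint I) T
  | [] => .word []
  | t :: ts => .concat (term t) (termList ts)
end

/-- The ranks of the nonterminals: `0` for a label of substitution nodes, `1` for a label together
with an adjoining constraint. -/
def termRank {N I : Type} : N ⊕ N × AdjConstraint I → ℕ
  | .inl _ => 0
  | .inr _ => 1

mutual
theorem rank_term {N I : Type} (t : TagTree N T I) : (term t).rank termRank = t.feet.length := by
  cases t with
  | leaf x => rfl
  | substNode X => rfl
  | foot X C => rfl
  | node X C ts =>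
    simp only [term, feet, DTerm.rank, termRank, rank_termList ts]
    omega
theorem rank_termList {N I : Type} (ts : List (TagTree N T I)) :
    (termList ts).rank termRank = (feetList ts).length := by
  cases ts with
  | nil => rfl
  | cons t ts => simp [termList, feetList, DTerm.rank, rank_term t, rank_termList ts]
end

mutual
theorem correct_term {N I : Type} (t : TagTree N T I) (h : t.feet.length ≤ 1) :
    (term t).Correct termRank 1 := by
  cases t with
  | leaf x => trivial
  | substNode X => trivial
  | foot X C => trivial
  | node X C ts =>
    refine ⟨trivial, correct_termList ts h, le_rfl, le_rfl, le_rfl, ?_⟩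
    rw [rank_termList]
    exact Nat.add_le_add le_rfl h
theorem correct_termList {N I : Type} (ts : List (TagTree N T I))
    (h : (feetList ts).length ≤ 1) : (termList ts).Correct termRank 1 := by
  cases ts with
  | nil => trivial
  | cons t ts =>
    rw [feetList, List.length_append] at h
    refine ⟨correct_term t (by omega), correct_termList ts (by omega), ?_⟩
    rwa [rank_term, rank_termList]
end

theorem finite_adjConstraint (I : Type) [Finite I] : Finite (AdjConstraint I) :=
  Finite.of_injective (fun C => (C.allowed, C.obligatory)) fun C D h => by
    cases C; cases D; simp_all

/-- The displacement grammar of a tree-adjoining grammar: the nonterminal of a substitution node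
is rewritten to an initial tree, and that of a node to an auxiliary tree that may be adjoined
there, or to the separator if nothing need be adjoined. -/
def toDCFG (G : TAG T) : DCFG 1 T where
  N := G.N ⊕ G.N × AdjConstraint G.Aux
  finite_N := by
    have := G.finite_N
    have := G.finite_Aux
    have := finite_adjConstraint G.Aux
    infer_instance
  rk := termRank
  rk_le A := by cases A <;> simp [termRank]
  start := .inl G.start
  rk_start := rfl
  rules := Set.range (fun i => (.inl (G.initLabel i), term (G.initTree i))) ∪
    {r | ∃ X C, C.obligatory = false ∧ r = (.inr (X, C), .sep)} ∪
    {r | ∃ b C, b ∈ C.allowed ∧ r = (.inr (G.auxLabel b, C), term (G.auxTree b))}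
  finite_rules := by
    have := G.finite_N
    have := G.finite_Aux
    have := G.finite_Init
    have := finite_adjConstraint G.Aux
    refine ((Set.finite_range _).union ?_).union ?_
    · refine (Set.finite_range fun p : G.N × AdjConstraint G.Aux =>
        ((.inr p, .sep) : _ × DTerm (G.N ⊕ G.N × AdjConstraint G.Aux) T)).subset ?_
      rintro _ ⟨X, C, -, rfl⟩
      exact ⟨(X, C), rfl⟩
    · refine (Set.finite_range fun p : G.Aux × AdjConstraint G.Aux =>
        ((.inr (G.auxLabel p.1, p.2), term (G.auxTree p.1)) :
          _ × DTerm (G.N ⊕ G.N × AdjConstraint G.Aux) T)).subset ?_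
      rintro _ ⟨b, C, -, rfl⟩
      exact ⟨(b, C), rfl⟩
  correct_of_mem A α h := by
    rcases h with (⟨i, h⟩ | ⟨X, C, -, h⟩) | ⟨b, C, -, h⟩ <;> cases h
    · exact correct_term _ (by rw [G.init_feet]; simp)
    · trivial
    · exact correct_term _ (by rw [G.aux_feet]; simp)
  rank_of_mem A α h := by
    rcases h with (⟨i, h⟩ | ⟨X, C, -, h⟩) | ⟨b, C, -, h⟩ <;> cases h
    · rw [rank_term, G.init_feet]; rfl
    · rfl
    · rw [rank_term, G.aux_feet]; rfl

variable {G : TAG T}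

/-! ### Derived trees yield derivable values -/

theorem exists_pair_of_val_adjoin {X : G.N} {C : AdjConstraint G.Aux} {u : List (Option T)}
    (h : G.toDCFG.Val (.nonterminal (.inr (X, C))) u) : ∃ p q : List T,
      u = p.map some ++ none :: q.map some :=
  eq_pair_of_sepCount_eq_one (DCFG.Val.sepCount_eq (G := G.toDCFG)
    (α := .nonterminal (Sum.inr (X, C))) trivial h)

mutual
theorem plug_eq_self (cs : List (TagTree G.N T G.Aux)) (t : TagTree G.N T G.Aux)
    (h : t.feet = []) : t.plug cs = t := by
  cases t with
  | leaf x => rfl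
  | substNode X => rfl
  | foot X C => simp [feet] at h
  | node X C ts => rw [plug, plugList_eq_self cs ts h]
theorem plugList_eq_self (cs : List (TagTree G.N T G.Aux)) (ts : List (TagTree G.N T G.Aux))
    (h : feetList ts = []) : plugList cs ts = ts := by
  cases ts with
  | nil => rfl
  | cons t ts =>
    rw [feetList, List.append_eq_nil_iff] at h
    rw [plugList, plug_eq_self cs t h.1, plugList_eq_self cs ts h.2]
end

theorem intercalation_intercalation {p q : List T} {v w : List (Option T)}
    (hv : sepCount v = 1) :
    intercalation 1 (p.map some ++ none :: q.map some) (intercalation 1 v w) =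
      intercalation 1 (intercalation 1 (p.map some ++ none :: q.map some) v) w := by
  obtain ⟨p', q', rfl⟩ := eq_pair_of_sepCount_eq_one hv
  have := intercalation_pair (p ++ p') (q'.map some ++ q.map some) w
  simp only [List.map_append, List.append_assoc] at this
  simp [this]

mutual
/-- Attaching subtrees below the only foot node fills the separator of the values of the tree. -/
theorem val_of_plug (cs : List (TagTree G.N T G.Aux)) (t : TagTree G.N T G.Aux)
    (ht : t.feet.length = 1) {u : List (Option T)} (h : G.toDCFG.Val (term (t.plug cs)) u) :
    ∃ v w, G.toDCFG.Val (term t) v ∧ G.toDCFG.Val (termList cs) w ∧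
      u = intercalation 1 v w := by
  cases t with
  | leaf x => simp [feet] at ht
  | substNode X => simp [feet] at ht
  | foot X C =>
    rw [plug, term] at h
    obtain ⟨v, w, hv, hw, rfl⟩ := DCFG.Val.exists_of_inter h
    exact ⟨v, w, hv, hw, rfl⟩
  | node X C ts =>
    rw [plug, term] at h
    rw [feet] at ht
    obtain ⟨v, w, hv, hw, rfl⟩ := DCFG.Val.exists_of_inter h
    obtain ⟨v', w', hv', hw', rfl⟩ := val_of_plugList cs ts ht hw
    obtain ⟨p, q, rfl⟩ := exists_pair_of_val_adjoin hv
    refine ⟨intercalation 1 (p.map some ++ none :: q.map some) v', w', ?_, hw',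
      intercalation_intercalation ?_⟩
    · rw [term]
      exact .inter _ _ _ _ _ hv hv'
    · exact (hv'.sepCount_eq (correct_termList ts ht.le)).trans ((rank_termList ts).trans ht)
theorem val_of_plugList (cs : List (TagTree G.N T G.Aux)) (ts : List (TagTree G.N T G.Aux))
    (ht : (feetList ts).length = 1) {u : List (Option T)}
    (h : G.toDCFG.Val (termList (plugList cs ts)) u) :
    ∃ v w, G.toDCFG.Val (termList ts) v ∧ G.toDCFG.Val (termList cs) w ∧
      u = intercalation 1 v w := by
  cases ts with
  | nil => simp [feetList] at ht
  | cons t ts =>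
    rw [feetList, List.length_append] at ht
    rw [plugList, termList] at h
    obtain ⟨v, w, hv, hw, rfl⟩ := DCFG.Val.exists_of_concat h
    rcases Nat.eq_zero_or_pos t.feet.length with h0 | h0
    · obtain ⟨v', w', hv', hw', rfl⟩ := val_of_plugList cs ts (by omega) hw
      rw [plug_eq_self cs t (List.eq_nil_of_length_eq_zero h0)] at hv
      refine ⟨_, w', by rw [termList]; exact .concat _ _ _ _ hv hv', hw', ?_⟩
      obtain ⟨x, rfl⟩ := eq_map_some_of_sepCount_eq_zero
        ((hv.sepCount_eq (correct_term t (by omega))).trans ((rank_term t).trans h0))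
      obtain ⟨p, q, rfl⟩ := eq_pair_of_sepCount_eq_one
        ((hv'.sepCount_eq (correct_termList ts (by omega))).trans
          ((rank_termList ts).trans (by omega)))
      have := intercalation_pair (x ++ p) (q.map some) w'
      simp only [List.map_append, List.append_assoc] at this
      simp [this]
    · obtain ⟨v', w', hv', hw', rfl⟩ := val_of_plug cs t (by omega) hv
      rw [plugList_eq_self cs ts (List.eq_nil_of_length_eq_zero (by omega))] at hw
      refine ⟨_, w', by rw [termList]; exact .concat _ _ _ _ hv' hw, hw', ?_⟩
      obtain ⟨p, q, rfl⟩ := eq_pair_of_sepCount_eq_one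
        ((hv'.sepCount_eq (correct_term t (by omega))).trans
          ((rank_term t).trans (by omega)))
      have := intercalation_pair p (q.map some ++ w) w'
      simp [this]
end

theorem val_append_cons {l r : List (TagTree G.N T G.Aux)} {t t' : TagTree G.N T G.Aux}
    (h : ∀ u, G.toDCFG.Val (term t') u → G.toDCFG.Val (term t) u) {u : List (Option T)}
    (hu : G.toDCFG.Val (termList (l ++ t' :: r)) u) :
    G.toDCFG.Val (termList (l ++ t :: r)) u := by
  induction l generalizing u with
  | nil =>
    rw [List.nil_append, termList] at hu ⊢
    obtain ⟨v, w, hv, hw, rfl⟩ := DCFG.Val.exists_of_concat hu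
    exact .concat _ _ _ _ (h _ hv) hw
  | cons s l ih =>
    rw [List.cons_append, termList] at hu ⊢
    obtain ⟨v, w, hv, hw, rfl⟩ := DCFG.Val.exists_of_concat hu
    exact .concat _ _ _ _ hv (ih hw)

theorem val_of_step {t t' : TagTree G.N T G.Aux} (h : G.Step t t') {u : List (Option T)}
    (hu : G.toDCFG.Val (term t') u) : G.toDCFG.Val (term t) u := by
  induction h generalizing u with
  | adjoin C ts b hb =>
    obtain ⟨v, w, hv, hw, rfl⟩ := val_of_plug ts (G.auxTree b) (by rw [G.aux_feet]; rfl) hu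
    rw [term]
    exact .inter _ _ _ _ _ (.nonterminal _ _ _ (.inr ⟨b, C, hb, rfl⟩) hv) hw
  | substitute i => exact .nonterminal _ _ _ (.inl (.inl ⟨i, rfl⟩)) hu
  | child X C l r t t' h ih =>
    rw [term] at hu ⊢
    obtain ⟨v, w, hv, hw, rfl⟩ := DCFG.Val.exists_of_inter hu
    exact .inter _ _ _ _ _ hv (val_append_cons (fun _ => ih) hw)

mutual
theorem val_of_complete (t : TagTree G.N T G.Aux) (h : t.Complete) :
    G.toDCFG.Val (term t) (t.yield.map some) := by
  cases t with
  | leaf x => exact .word _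
  | substNode X => exact h.elim
  | foot X C => exact h.elim
  | node X C ts =>
    have := DCFG.Val.inter (G := G.toDCFG) 1 (.nonterminal (.inr (X, C))) _ _ _
      (.nonterminal _ _ _ (.inl (.inr ⟨X, C, h.1, rfl⟩)) .sep) (val_of_completeList ts h.2)
    rw [term, TagTree.yield]
    simp only [intercalation, if_pos, List.append_nil] at this
    exact this
theorem val_of_completeList (ts : List (TagTree G.N T G.Aux)) (h : CompleteList ts) :
    G.toDCFG.Val (termList ts) ((yieldList ts).map some) := by
  cases ts with
  | nil => exact .word _
  | cons t ts =>
    rw [yieldList, List.map_append]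
    exact .concat _ _ _ _ (val_of_complete t h.1) (val_of_completeList ts h.2)
end

/-! ### Derivable values are yields of derived trees -/

/-- The tree `t` can be completed to a tree with yield `w`. -/
def Completes (G : TAG T) (t : TagTree G.N T G.Aux) (w : List T) : Prop :=
  ∃ t', Relation.ReflTransGen G.Step t t' ∧ t'.Complete ∧ t'.yield = w

/-- The trees of the list can be completed to trees whose yields have the concatenation `w`. -/
def CompletesList (G : TAG T) (ts : List (TagTree G.N T G.Aux)) (w : List T) : Prop :=
  ∃ ts', List.Forall₂ (Relation.ReflTransGen G.Step) ts ts' ∧ CompleteList ts' ∧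
    yieldList ts' = w

theorem step_children {X : G.N} {C : AdjConstraint G.Aux} {ts ts' : List (TagTree G.N T G.Aux)}
    (h : List.Forall₂ (Relation.ReflTransGen G.Step) ts ts') (l : List (TagTree G.N T G.Aux)) :
    Relation.ReflTransGen G.Step (.node X C (l ++ ts)) (.node X C (l ++ ts')) := by
  induction h generalizing l with
  | nil => exact .refl
  | @cons t t' ts ts' h _ ih =>
    have h1 : Relation.ReflTransGen G.Step (.node X C (l ++ t :: ts)) (.node X C (l ++ t' :: ts)) :=
      Relation.ReflTransGen.lift (p := G.Step) (fun s => TagTree.node X C (l ++ s :: ts))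
        (fun _ _ h => Step.child _ _ _ _ _ _ h) _ _ h
    have h2 := ih (l ++ [t'])
    simp only [List.append_assoc, List.cons_append, List.nil_append] at h2
    exact h1.trans h2

/-- What a derivable value of a nonterminal means in terms of trees: a value of the nonterminal
of a substitution node is the yield of a tree derived from that node, and a value of the
nonterminal of an inner node is what adjunctions at that node put around the yield of its
children. -/
def TreeValue (G : TAG T) (A : G.N ⊕ G.N × AdjConstraint G.Aux) (u : List (Option T)) : Prop :=
  sepCount u = termRank A ∧ ∀ cs, CompleteList cs →
    match A with
    | .inl X => G.Completes (.substNode X) (fill (yieldList cs) u)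
    | .inr (X, C) => G.Completes (.node X C cs) (fill (yieldList cs) u)

theorem Completes.head {t t' : TagTree G.N T G.Aux} {w : List T}
    (h : Relation.ReflTransGen G.Step t t') (h' : G.Completes t' w) : G.Completes t w := by
  obtain ⟨t'', h1, h2⟩ := h'
  exact ⟨t'', h.trans h1, h2⟩

mutual
theorem completes_plug {cs : List (TagTree G.N T G.Aux)} (hcs : CompleteList cs)
    (t : TagTree G.N T G.Aux) {u : List (Option T)} (h : (term t).ValueIn G.TreeValue u) :
    G.Completes (t.plug cs) (fill (yieldList cs) u) := by
  cases t with
  | leaf x =>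
    rw [show u = x.toList.map some from h, fill_map_some]
    exact ⟨_, .refl, trivial, rfl⟩
  | substNode X => exact h.2 cs hcs
  | foot X C => exact h.2 cs hcs
  | node X C ts =>
    rw [term] at h
    obtain ⟨v, w, ⟨hs, hv⟩, hw, rfl⟩ := h
    obtain ⟨p, q, rfl⟩ := eq_pair_of_sepCount_eq_one hs
    obtain ⟨ts', h1, h2, h3⟩ := completesList_plugList hcs ts hw
    have := Completes.head (step_children (X := X) (C := C) h1 []) (hv ts' h2)
    rw [h3] at this
    simpa [plug] using this
theorem completesList_plugList {cs : List (TagTree G.N T G.Aux)} (hcs : CompleteList cs)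
    (ts : List (TagTree G.N T G.Aux)) {u : List (Option T)}
    (h : (termList ts).ValueIn G.TreeValue u) :
    G.CompletesList (plugList cs ts) (fill (yieldList cs) u) := by
  cases ts with
  | nil =>
    rw [show u = ([] : List T).map some from h, fill_map_some]
    exact ⟨[], .nil, trivial, rfl⟩
  | cons t ts =>
    obtain ⟨v, w, hv, hw, rfl⟩ := h
    obtain ⟨t', h1, h2, h3⟩ := completes_plug hcs t hv
    obtain ⟨ts', h1', h2', h3'⟩ := completesList_plugList hcs ts hw
    exact ⟨t' :: ts', .cons h1 h1', ⟨h2, h2'⟩, by rw [yieldList, h3, h3', fill_append]⟩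
end

theorem treeValue_of_rule (A : G.toDCFG.N) (α : DTerm G.toDCFG.N T) (u : List (Option T))
    (hr : (A, α) ∈ G.toDCFG.rules) (h : α.ValueIn G.TreeValue u) : G.TreeValue A u := by
  have hs : sepCount u = termRank A := by
    rw [DTerm.ValueIn.sepCount_eq (rk := termRank) (fun A u h => h.1)
      (G.toDCFG.correct_of_mem A α hr) h]
    exact G.toDCFG.rank_of_mem A α hr
  refine ⟨hs, fun cs hcs => ?_⟩
  rcases hr with (⟨i, e⟩ | ⟨X, C, hC, e⟩) | ⟨b, C, hb, e⟩ <;> cases e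
  · have := completes_plug hcs _ h
    rw [plug_eq_self _ _ (G.init_feet i)] at this
    exact Completes.head (.single (.substitute i)) this
  · rw [show u = [none] from h]
    exact ⟨_, .refl, ⟨hC, hcs⟩, by simp [fill, TagTree.yield]⟩
  · exact Completes.head (.single (.adjoin C cs b hb)) (completes_plug hcs _ h)

theorem exists_initTree_of_completes {X : G.N} {w : List T} (h : G.Completes (.substNode X) w) :
    ∃ i, G.initLabel i = X ∧ G.Completes (G.initTree i) w := by
  obtain ⟨t, h1, h2, h3⟩ := h
  rcases Relation.ReflTransGen.cases_head h1 with rfl | ⟨t', h4, h5⟩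
  · exact h2.elim
  · cases h4 with
    | substitute i => exact ⟨i, rfl, t, h5, h2, h3⟩

theorem language_toDCFG (G : TAG T) : G.toDCFG.language = G.language := by
  ext w
  rw [DCFG.mem_language]
  constructor
  · intro h
    have h1 : G.Completes (.substNode G.start) (fill (yieldList []) (w.map some)) :=
      (h.valueIn treeValue_of_rule).2 [] trivial
    rw [fill_map_some] at h1
    obtain ⟨i, hi, t, h1, h2, h3⟩ := exists_initTree_of_completes h1
    exact ⟨i, t, hi, h1, h2, h3⟩
  · rintro ⟨i, t, hi, h, hc, rfl⟩
    have h1 (s : TagTree G.N T G.Aux) (hs : Relation.ReflTransGen G.Step s t) :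
        G.toDCFG.Val (term s) (t.yield.map some) := by
      induction hs using Relation.ReflTransGen.head_induction_on with
      | refl => exact val_of_complete t hc
      | head h _ ih => exact val_of_step h ih
    exact .nonterminal _ _ _ (.inl (.inl ⟨i, by simp only [hi]; rfl⟩)) (h1 _ h)

end TAG

theorem IsTAL.isDCFL {T : Type} {L : Language T} (h : IsTAL L) : IsDCFL 1 L := by
  obtain ⟨G, rfl⟩ := h
  exact ⟨G.toDCFG, G.language_toDCFG⟩

/-! ### From well-nested multiple context-free grammars to displacement grammars -/

theorem not_sublist_swap {α : Type} {l : List α} (hl : l.Nodup) {x y : α}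
    (h : [x, y].Sublist l) : ¬ [y, x].Sublist l := by
  intro h'
  induction l with
  | nil => simp at h
  | cons z l ih =>
    have hz := (List.nodup_cons.1 hl).1
    cases h with
    | cons _ h =>
      cases h' with
      | cons _ h' => exact ih (List.nodup_cons.1 hl).2 h h'
      | cons_cons _ h' => exact hz (h.subset (by simp))
    | cons_cons _ h =>
      cases h' with
      | cons _ h' => exact hz (h'.subset (by simp))
      | cons_cons _ h' => exact hz (h'.subset (by simp))

/-- The words of a tuple, joined by separators. -/
def joinSep {T : Type} : List (List T) → List (Option T)
  | [] => []
  | [w] => w.map some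
  | w :: ws => w.map some ++ none :: joinSep ws

theorem joinSep_cons_cons {T : Type} (v w : List T) (ws : List (List T)) :
    joinSep (v :: w :: ws) = v.map some ++ none :: joinSep (w :: ws) := rfl

theorem sepCount_joinSep {T : Type} (ws : List (List T)) :
    sepCount (joinSep ws) = ws.length - 1 := by
  induction ws with
  | nil => rfl
  | cons w ws ih =>
    cases ws with
    | nil => simp [joinSep]
    | cons v ws => rw [joinSep_cons_cons, sepCount_append, sepCount_cons_none, ih]; simp

/-- The occurrences of variables of a rule with variables `(i, j)`, `j < d i`, where `d i ≤ 2`, are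
well-nested: with one variable of a group `i` all of them occur, once and in order, and the
variables of two groups do not cross. -/
structure NestedVars {ι : Type} (d : ι → ℕ) (vs : List (ι × ℕ)) : Prop where
  nodup : vs.Nodup
  lt : ∀ i j, (i, j) ∈ vs → j < d i
  paired : ∀ i j j', (i, j) ∈ vs → j' < d i → (i, j') ∈ vs
  ordered : ∀ i, ¬ [(i, 1), (i, 0)].Sublist vs
  not_cross : ∀ i i', i ≠ i' → ¬ [(i, 0), (i', 0), (i, 1), (i', 1)].Sublist vs

namespace NestedVars

variable {ι : Type} {d : ι → ℕ}

theorem eq_zero_of_cons {i : ι} {j : ℕ} {vs : List (ι × ℕ)} (hd : ∀ i, d i ≤ 2)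
    (h : NestedVars d ((i, j) :: vs)) : j = 0 := by
  have h1 := h.lt i j (by simp)
  have h2 := hd i
  by_contra hj
  obtain rfl : j = 1 := by omega
  have h3 := h.paired i 1 0 (by simp) (by omega)
  refine h.ordered i (.cons_cons _ (List.singleton_sublist.2 ?_))
  simpa using h3

theorem of_cons {i : ι} {vs : List (ι × ℕ)} (hi : d i = 1)
    (h : NestedVars d ((i, 0) :: vs)) : NestedVars d vs where
  nodup := (List.nodup_cons.1 h.nodup).2
  lt i' j hj := h.lt i' j (List.mem_cons_of_mem _ hj)
  paired i' j j' hj hj' := by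
    have h1 := h.paired i' j j' (List.mem_cons_of_mem _ hj) hj'
    have h2 := h.lt i' j (List.mem_cons_of_mem _ hj)
    rcases List.mem_cons.1 h1 with h1 | h1
    · obtain ⟨rfl, rfl⟩ := Prod.mk.inj h1
      obtain rfl : j = 0 := by omega
      exact hj
    · exact h1
  ordered i' h' := h.ordered i' (h'.cons _)
  not_cross i' i'' hi' h' := h.not_cross i' i'' hi' (h'.cons _)

/-- A group of two variables splits the remaining variables into those between and those behind
the two. -/
theorem split {i : ι} {ys zs : List (ι × ℕ)} (hd : ∀ i, d i ≤ 2)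
    (h : NestedVars d ((i, 0) :: (ys ++ (i, 1) :: zs))) :
    NestedVars d ys ∧ NestedVars d zs := by
  have hys : ys.Sublist ((i, 0) :: (ys ++ (i, 1) :: zs)) :=
    (List.sublist_append_left _ _).cons _
  have hzs : zs.Sublist ((i, 0) :: (ys ++ (i, 1) :: zs)) :=
    (((List.Sublist.refl zs).cons _).trans (List.sublist_append_right _ _)).cons _
  have hnd := h.nodup
  have hne (i' : ι) (j : ℕ) (hj : (i', j) ∈ ys ++ zs) : i' ≠ i := by
    rintro rfl
    have h1 : (i', j) ∈ (i', 0) :: (ys ++ (i', 1) :: zs) := by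
      rcases List.mem_append.1 hj with hj | hj
      · exact hys.subset hj
      · exact hzs.subset hj
    have h2 := h.lt i' j h1
    have h3 := hd i'
    have h4 : j = 0 ∨ j = 1 := by omega
    rcases h4 with rfl | rfl
    · simp only [List.nodup_cons, List.mem_append, List.mem_cons] at hnd hj
      tauto
    · rw [List.nodup_cons] at hnd
      have h5 := List.nodup_middle.1 hnd.2
      exact (List.nodup_cons.1 h5).1 hj
  have hout (i' : ι) (j j' : ℕ) (hj : (i', j) ∈ ys ++ zs) (hj' : j' < d i') :
      (i', j') ∈ ys ∨ (i', j') ∈ zs := by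
    have h0 := hne i' j hj
    have h1 : (i', j) ∈ (i, 0) :: (ys ++ (i, 1) :: zs) := by
      rcases List.mem_append.1 hj with hj | hj
      · exact hys.subset hj
      · exact hzs.subset hj
    have h2 := h.paired i' j j' h1 hj'
    simp only [List.mem_cons, List.mem_append, Prod.mk.injEq] at h2
    tauto
  have hcross (i' : ι) (h0 : (i', 0) ∈ ys) (h1 : (i', 1) ∈ zs) : False := by
    refine h.not_cross i i' (hne i' 0 (List.mem_append_left _ h0)).symm (.cons_cons _ ?_)
    exact (List.singleton_sublist.2 h0).append (.cons_cons _ (List.singleton_sublist.2 h1))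
  have horder (i' : ι) (h0 : (i', 1) ∈ ys) (h1 : (i', 0) ∈ zs) : False :=
    h.ordered i' (((List.singleton_sublist.2 h0).append
      ((List.singleton_sublist.2 h1).cons _)).cons _)
  refine ⟨⟨hys.nodup hnd, fun i' j hj => h.lt i' j (hys.subset hj), fun i' j j' hj hj' => ?_,
    fun i' h' => h.ordered i' (h'.trans hys),
    fun i' i'' hi' h' => h.not_cross i' i'' hi' (h'.trans hys)⟩,
    ⟨hzs.nodup hnd, fun i' j hj => h.lt i' j (hzs.subset hj), fun i' j j' hj hj' => ?_,
    fun i' h' => h.ordered i' (h'.trans hzs),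
    fun i' i'' hi' h' => h.not_cross i' i'' hi' (h'.trans hzs)⟩⟩
  · rcases hout i' j j' (List.mem_append_left _ hj) hj' with h1 | h1
    · exact h1
    · exfalso
      have h2 := h.lt i' j (hys.subset hj)
      have h3 := hd i'
      rcases (show j = j' ∨ (j = 0 ∧ j' = 1) ∨ (j = 1 ∧ j' = 0) by omega) with
        rfl | ⟨rfl, rfl⟩ | ⟨rfl, rfl⟩
      · have := (List.nodup_append.1 (List.nodup_cons.1 hnd).2).2.2 _ hj _
          (List.mem_cons_of_mem _ h1)
        exact this rfl
      · exact hcross i' hj h1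
      · exact horder i' hj h1
  · rcases hout i' j j' (List.mem_append_right _ hj) hj' with h1 | h1
    · exfalso
      have h2 := h.lt i' j (hzs.subset hj)
      have h3 := hd i'
      rcases (show j = j' ∨ (j = 0 ∧ j' = 1) ∨ (j = 1 ∧ j' = 0) by omega) with
        rfl | ⟨rfl, rfl⟩ | ⟨rfl, rfl⟩
      · have := (List.nodup_append.1 (List.nodup_cons.1 hnd).2).2.2 _ h1 _
          (List.mem_cons_of_mem _ hj)
        exact this rfl
      · exact horder i' h1 hj
      · exact hcross i' h1 hj
    · exact h1

end NestedVars

namespace DTerm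

variable {N N' T : Type}

/-- The occurrences of nonterminals in a term. -/
def nonterminals : DTerm N T → List N
  | nonterminal A => [A]
  | word _ => []
  | sep => []
  | concat α β => nonterminals α ++ nonterminals β
  | inter _ α β => nonterminals α ++ nonterminals β

/-- The term with its nonterminals renamed. -/
def rename (f : N → N') : DTerm N T → DTerm N' T
  | nonterminal A => nonterminal (f A)
  | word w => word w
  | sep => sep
  | concat α β => concat (rename f α) (rename f β)
  | inter j α β => inter j (rename f α) (rename f β)

theorem rank_rename (f : N → N') (rk : N' → ℕ) (α : DTerm N T) :
    (α.rename f).rank rk = α.rank (rk ∘ f) := by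
  induction α with
  | nonterminal A => rfl
  | word w => rfl
  | sep => rfl
  | concat α β ihα ihβ => simp [rename, rank, ihα, ihβ]
  | inter j α β ihα ihβ => simp [rename, rank, ihα, ihβ]

theorem correct_rename (f : N → N') (rk : N' → ℕ) (k : ℕ) {α : DTerm N T}
    (h : α.Correct (rk ∘ f) k) : (α.rename f).Correct rk k := by
  induction α with
  | nonterminal A => trivial
  | word w => trivial
  | sep => trivial
  | concat α β ihα ihβ =>
    exact ⟨ihα h.1, ihβ h.2.1, by rw [rank_rename, rank_rename]; exact h.2.2⟩
  | inter j α β ihα ihβ =>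
    obtain ⟨h1, h2, h3, h4, h5, h6⟩ := h
    exact ⟨ihα h1, ihβ h2, h3, h4, by rwa [rank_rename], by rwa [rank_rename, rank_rename]⟩

theorem value_congr {μ ν : N → List (Option T)} {α : DTerm N T}
    (h : ∀ A ∈ α.nonterminals, μ A = ν A) : α.value μ = α.value ν := by
  induction α with
  | nonterminal A => exact h A (by simp [nonterminals])
  | word w => rfl
  | sep => rfl
  | concat α β ihα ihβ =>
    rw [value, value, ihα fun A hA => h A (List.mem_append_left _ hA),
      ihβ fun A hA => h A (List.mem_append_right _ hA)]
  | inter j α β ihα ihβ =>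
    rw [value, value, ihα fun A hA => h A (List.mem_append_left _ hA),
      ihβ fun A hA => h A (List.mem_append_right _ hA)]

theorem valueIn_rename_value {f : N → N'} {R : N' → List (Option T) → Prop}
    {μ : N → List (Option T)} (h : ∀ A, R (f A) (μ A)) (α : DTerm N T) :
    (α.rename f).ValueIn R (α.value μ) := by
  induction α with
  | nonterminal A => exact h A
  | word w => rfl
  | sep => rfl
  | concat α β ihα ihβ => exact ⟨_, _, ihα, ihβ, rfl⟩
  | inter j α β ihα ihβ => exact ⟨_, _, ihα, ihβ, rfl⟩

open Classical in
/-- In a term without repeated nonterminals, choosing values independently at each occurrence of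
a nonterminal amounts to choosing a valuation. -/
theorem exists_value_of_valueIn_rename {f : N → N'} {R : N' → List (Option T) → Prop}
    {α : DTerm N T} (hα : α.nonterminals.Nodup) {u : List (Option T)}
    (h : (α.rename f).ValueIn R u) :
    ∃ μ : N → List (Option T), (∀ A ∈ α.nonterminals, R (f A) (μ A)) ∧ u = α.value μ := by
  have glue {α β : DTerm N T} (hd : (α.nonterminals ++ β.nonterminals).Nodup)
      {μ ν : N → List (Option T)} (hμ : ∀ A ∈ α.nonterminals, R (f A) (μ A))
      (hν : ∀ A ∈ β.nonterminals, R (f A) (ν A)) :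
      ∃ ξ : N → List (Option T), (∀ A ∈ α.nonterminals ++ β.nonterminals, R (f A) (ξ A)) ∧
        α.value μ = α.value ξ ∧ β.value ν = β.value ξ := by
    refine ⟨fun A => if A ∈ α.nonterminals then μ A else ν A, fun A hA => ?_,
      value_congr fun A hA => (if_pos hA).symm, value_congr fun A hA => (if_neg ?_).symm⟩
    · by_cases h : A ∈ α.nonterminals
      · simpa [h] using hμ A h
      · simpa [h] using hν A ((List.mem_append.1 hA).resolve_left h)
    · exact fun hA' => (List.nodup_append.1 hd).2.2 A hA' A hA rfl
  induction α generalizing u with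
  | nonterminal A => exact ⟨fun _ => u, fun A' hA => by rwa [List.mem_singleton.1 hA], rfl⟩
  | word w => exact ⟨fun _ => [], by simp [nonterminals], h⟩
  | sep => exact ⟨fun _ => [], by simp [nonterminals], h⟩
  | concat α β ihα ihβ =>
    obtain ⟨v, w, hv, hw, rfl⟩ := h
    have hd := List.nodup_append.1 hα
    obtain ⟨μ, hμ, rfl⟩ := ihα hd.1 hv
    obtain ⟨ν, hν, rfl⟩ := ihβ hd.2.1 hw
    obtain ⟨ξ, hξ, e1, e2⟩ := glue hα hμ hν
    exact ⟨ξ, hξ, by rw [value, e1, e2]⟩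
  | inter j α β ihα ihβ =>
    obtain ⟨v, w, hv, hw, rfl⟩ := h
    have hd := List.nodup_append.1 hα
    obtain ⟨μ, hμ, rfl⟩ := ihα hd.1 hv
    obtain ⟨ν, hν, rfl⟩ := ihβ hd.2.1 hw
    obtain ⟨ξ, hξ, e1, e2⟩ := glue hα hμ hν
    exact ⟨ξ, hξ, by rw [value, e1, e2]⟩

end DTerm

namespace MCFRule

variable {ι T : Type}

/-- The variables in a word over terminals, variables and the separator. -/
def symbolVars (X : List (Option (T ⊕ (ι × ℕ)))) : List (ι × ℕ) :=
  X.filterMap fun s => s.bind Sum.getRight?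

/-- The word obtained by substituting the components of the tuples `μ i` for the variables. -/
def substSymbols (μ : ι → List (List T)) (X : List (Option (T ⊕ (ι × ℕ)))) : List (Option T) :=
  X.flatMap fun
    | none => [none]
    | some (.inl x) => [some x]
    | some (.inr (i, j)) => ((μ i).getD j []).map some

theorem symbolVars_append (X Y : List (Option (T ⊕ (ι × ℕ)))) :
    symbolVars (X ++ Y) = symbolVars X ++ symbolVars Y := List.filterMap_append

theorem substSymbols_append (μ : ι → List (List T)) (X Y : List (Option (T ⊕ (ι × ℕ)))) :
    substSymbols μ (X ++ Y) = substSymbols μ X ++ substSymbols μ Y := List.flatMap_append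

theorem substSymbols_cons (μ : ι → List (List T)) (s : Option (T ⊕ (ι × ℕ)))
    (X : List (Option (T ⊕ (ι × ℕ)))) :
    substSymbols μ (s :: X) = substSymbols μ [s] ++ substSymbols μ X :=
  substSymbols_append μ [s] X

theorem symbolVars_joinSep (ss : List (List (T ⊕ (ι × ℕ)))) :
    symbolVars (joinSep ss) = ss.flatten.filterMap Sum.getRight? := by
  have h (s : List (T ⊕ (ι × ℕ))) : symbolVars (s.map some) = s.filterMap Sum.getRight? := by
    simp [symbolVars, List.filterMap_map]
  induction ss with
  | nil => rfl
  | cons s ss ih =>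
    cases ss with
    | nil => simp [joinSep, h]
    | cons s' ss =>
      rw [joinSep_cons_cons, symbolVars_append, h, List.flatten_cons, List.filterMap_append, ← ih]
      rfl

theorem substSymbols_joinSep {n : ℕ} (ws : Fin n → List (List T))
    (ss : List (List (T ⊕ (Fin n × ℕ)))) :
    substSymbols ws (joinSep ss) = joinSep (ss.map (instantiate ws)) := by
  have h (s : List (T ⊕ (Fin n × ℕ))) :
      substSymbols ws (s.map some) = (instantiate ws s).map some := by
    induction s with
    | nil => rfl
    | cons x s ih =>
      rw [List.map_cons, substSymbols_cons, ih]
      rcases x with x | ⟨i, j⟩ <;> simp [substSymbols, instantiate]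
  induction ss with
  | nil => rfl
  | cons s ss ih =>
    cases ss with
    | nil => simp [joinSep, h]
    | cons s' ss =>
      rw [joinSep_cons_cons, substSymbols_append, h, List.map_cons, List.map_cons,
        joinSep_cons_cons, ← List.map_cons, ← ih]
      rfl

/-- A well-nested word with at most one separator is the value of a `1`-correct term: a
group of one variable or a terminal at the front is split off by concatenation, and a group of two
variables is wrapped around the part between them. -/
theorem exists_term {d : ι → ℕ} (hd1 : ∀ i, 1 ≤ d i) (hd2 : ∀ i, d i ≤ 2)
    (X : List (Option (T ⊕ (ι × ℕ)))) (hX : NestedVars d (symbolVars X)) (hs : sepCount X ≤ 1) :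
    ∃ τ : DTerm ι T, τ.Correct (fun i => d i - 1) 1 ∧ τ.rank (fun i => d i - 1) = sepCount X ∧
      τ.nonterminals.Nodup ∧ (∀ i, i ∈ τ.nonterminals ↔ (i, 0) ∈ symbolVars X) ∧
      ∀ μ : ι → List (List T), (∀ i, (μ i).length = d i) →
        τ.value (fun i => joinSep (μ i)) = substSymbols μ X := by
  induction hn : X.length using Nat.strong_induction_on generalizing X with
  | _ n ih =>
  subst hn
  match X with
  | [] => exact ⟨.word [], trivial, rfl, by simp [DTerm.nonterminals],
      by simp [DTerm.nonterminals, symbolVars], fun μ _ => rfl⟩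
  | none :: X =>
    obtain ⟨τ, h1, h2, h3, h4, h5⟩ := ih X.length (by simp) X hX (by simp at hs; omega) rfl
    refine ⟨.concat .sep τ, ⟨trivial, h1, ?_⟩, ?_, h3, h4, fun μ hμ => ?_⟩
    · simp only [DTerm.rank, h2]; simp at hs; omega
    · simp only [DTerm.rank, h2, sepCount_cons_none]; omega
    · rw [DTerm.value, h5 μ hμ]; rfl
  | some (.inl x) :: X =>
    obtain ⟨τ, h1, h2, h3, h4, h5⟩ := ih X.length (by simp) X hX (by simpa using hs) rfl
    refine ⟨.concat (.word [x]) τ, ⟨trivial, h1, ?_⟩, ?_, h3, h4, fun μ hμ => ?_⟩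
    · simpa [DTerm.rank, h2] using hs
    · simp [DTerm.rank, h2]
    · rw [DTerm.value, h5 μ hμ]; rfl
  | some (.inr (i, j)) :: X =>
    have hX' : NestedVars d ((i, j) :: symbolVars X) := hX
    obtain rfl := hX'.eq_zero_of_cons hd2
    have hi : d i = 1 ∨ d i = 2 := by have := hd1 i; have := hd2 i; omega
    rcases hi with hi | hi
    · obtain ⟨τ, h1, h2, h3, h4, h5⟩ := ih X.length (by simp) X (hX'.of_cons hi)
        (by simpa using hs) rfl
      refine ⟨.concat (.nonterminal i) τ, ⟨trivial, h1, ?_⟩, ?_, ?_, fun i' => ?_, fun μ hμ => ?_⟩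
      · simpa [DTerm.rank, h2, hi] using hs
      · simp [DTerm.rank, h2, hi]
      · refine List.nodup_cons.2 ⟨fun h => ?_, h3⟩
        exact (List.nodup_cons.1 hX'.nodup).1 ((h4 i).1 h)
      · change i' ∈ i :: τ.nonterminals ↔ (i', 0) ∈ (i, 0) :: symbolVars X
        simp [h4]
      · rw [DTerm.value, h5 μ hμ, substSymbols_cons _ _ X]
        obtain ⟨w, hw⟩ := List.length_eq_one_iff.1 ((hμ i).trans hi)
        simp [DTerm.value, substSymbols, hw, joinSep]
    · have h1 : (i, 1) ∈ symbolVars X := by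
        simpa using hX'.paired i 0 1 (by simp) (by omega)
      have h2 : some (.inr (i, 1)) ∈ X := by
        obtain ⟨s, hs, he⟩ := List.mem_filterMap.1 h1
        rcases s with _ | x | v
        · simp at he
        · simp at he
        · simp at he; rwa [he] at hs
      obtain ⟨Y, Z, rfl⟩ := List.append_of_mem h2
      have e : symbolVars (Y ++ some (.inr (i, 1)) :: Z) =
          symbolVars Y ++ (i, 1) :: symbolVars Z := by rw [symbolVars_append]; rfl
      rw [e] at hX'
      obtain ⟨hY, hZ⟩ := hX'.split hd2
      simp only [sepCount_cons_some, sepCount_append] at hs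
      obtain ⟨σ, s1, s2, s3, s4, s5⟩ := ih Y.length (by simp) Y hY (by omega) rfl
      obtain ⟨τ, t1, t2, t3, t4, t5⟩ := ih Z.length (by simp; omega) Z hZ (by omega) rfl
      refine ⟨.concat (.inter 1 (.nonterminal i) σ) τ,
        ⟨⟨trivial, s1, le_rfl, le_rfl, ?_, ?_⟩, t1, ?_⟩, ?_, ?_, fun i' => ?_, fun μ hμ => ?_⟩
      · simp [DTerm.rank, hi]
      · simp only [DTerm.rank, hi, s2]; omega
      · simp only [DTerm.rank, hi, s2, t2]; omega
      · simp only [DTerm.rank, hi, s2, t2, sepCount_cons_some, sepCount_append]; omega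
      · have hnd := hX'.nodup
        simp only [List.nodup_cons, List.nodup_append, List.mem_append, List.mem_cons] at hnd
        change (i :: (σ.nonterminals ++ τ.nonterminals)).Nodup
        refine List.nodup_cons.2 ⟨fun h => ?_, List.nodup_append.2 ⟨s3, t3, ?_⟩⟩
        · rw [List.mem_append, s4, t4] at h
          tauto
        · rintro a ha _ hb rfl
          exact hnd.2.2.2 _ ((s4 a).1 ha) _ (.inr ((t4 a).1 hb)) rfl
      · change i' ∈ i :: (σ.nonterminals ++ τ.nonterminals) ↔
          (i', 0) ∈ (i, 0) :: symbolVars (Y ++ some (.inr (i, 1)) :: Z)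
        rw [e]
        simp [s4, t4]
      · obtain ⟨w, w', hw⟩ := List.length_eq_two.1 ((hμ i).trans hi)
        simp only [DTerm.value]
        rw [s5 μ hμ, t5 μ hμ, hw, joinSep_cons_cons, intercalation_pair,
          substSymbols_cons _ _ (Y ++ _), substSymbols_append, substSymbols_cons _ _ Z]
        simp [substSymbols, hw, joinSep]

end MCFRule

namespace WMCFG

variable {T : Type}

theorem exists_term (G : WMCFG 2 T) {r : MCFRule G.N T} (hr : r ∈ G.rules) :
    ∃ τ : DTerm (Fin r.arity) T, τ.Correct (fun i => G.dim (r.rhs i) - 1) 1 ∧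
      τ.rank (fun i => G.dim (r.rhs i) - 1) = G.dim r.lhs - 1 ∧
      τ.nonterminals.Nodup ∧ (∀ i, i ∈ τ.nonterminals) ∧
      ∀ ws : Fin r.arity → List (List T), (∀ i, (ws i).length = G.dim (r.rhs i)) →
        τ.value (fun i => joinSep (ws i)) = joinSep (r.comps.map (MCFRule.instantiate ws)) := by
  obtain ⟨h1, h2, h3⟩ := G.wellFormed r hr
  obtain ⟨h4, h5⟩ := G.wellNested r hr
  have hv : MCFRule.symbolVars (joinSep r.comps) = r.vars := MCFRule.symbolVars_joinSep _
  have hX : NestedVars (fun i => G.dim (r.rhs i)) (MCFRule.symbolVars (joinSep r.comps)) := by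
    rw [hv]
    refine ⟨h2, fun i j hj => (h3 i j).1 hj, fun i j j' _ hj' => (h3 i j').2 hj', fun i h => ?_,
      fun i i' hi => h5 i i' 0 0 hi⟩
    exact not_sublist_swap h2 (h4 i 0 ((h3 i 1).1 (h.subset (by simp)))) h
  have hs : sepCount (joinSep r.comps) = G.dim r.lhs - 1 := by rw [sepCount_joinSep, h1]
  obtain ⟨τ, t1, t2, t3, t4, t5⟩ := MCFRule.exists_term (fun i => G.one_le_dim (r.rhs i))
    (fun i => G.dim_le (r.rhs i)) _ hX (by have := G.dim_le r.lhs; omega)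
  refine ⟨τ, t1, t2.trans hs, t3, fun i => ?_, fun ws hws => ?_⟩
  · rw [t4, hv, h3]
    exact G.one_le_dim _
  · rw [t5 ws hws, MCFRule.substSymbols_joinSep]

/-- The displacement grammar with the same nonterminals, in which a tuple of words is represented
by its components joined by separators. -/
noncomputable def toDCFG (G : WMCFG 2 T) : DCFG 1 T where
  N := G.N
  finite_N := G.finite_N
  rk A := G.dim A - 1
  rk_le A := by have := G.dim_le A; omega
  start := G.start
  rk_start := by rw [G.dim_start]
  rules := Set.range fun r : G.rules => (r.1.lhs, (G.exists_term r.2).choose.rename r.1.rhs)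
  finite_rules := by
    have := G.finite_rules.to_subtype
    exact Set.finite_range _
  correct_of_mem A α h := by
    obtain ⟨r, e⟩ := h
    cases e
    exact DTerm.correct_rename _ _ _ (G.exists_term r.2).choose_spec.1
  rank_of_mem A α h := by
    obtain ⟨r, e⟩ := h
    cases e
    rw [DTerm.rank_rename]
    exact (G.exists_term r.2).choose_spec.2.1

theorem Derives.length_eq {G : WMCFG 2 T} {A : G.N} {t : List (List T)} (h : G.Derives A t) :
    t.length = G.dim A := by
  cases h with
  | rule r hr ws h => rw [List.length_map, (G.wellFormed r hr).1]

theorem Derives.val {G : WMCFG 2 T} {A : G.N} {t : List (List T)} (h : G.Derives A t) :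
    G.toDCFG.Val (.nonterminal A) (joinSep t) := by
  induction h with
  | rule r hr ws h ih =>
    obtain ⟨-, -, -, -, h5⟩ := (G.exists_term hr).choose_spec
    refine .nonterminal _ _ _ ⟨⟨r, hr⟩, rfl⟩ ?_
    rw [← h5 ws fun i => (h i).length_eq]
    exact DCFG.Val.of_valueIn (R := fun A u => G.toDCFG.Val (.nonterminal A) u)
      (fun _ _ h => h) (DTerm.valueIn_rename_value (f := r.rhs)
        (R := fun A u => G.toDCFG.Val (.nonterminal A) u) ih _)

theorem exists_derives_of_val {G : WMCFG 2 T} {A : G.N} {u : List (Option T)}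
    (h : G.toDCFG.Val (.nonterminal A) u) : ∃ t, G.Derives A t ∧ u = joinSep t := by
  refine h.valueIn (R := fun A u => ∃ t, G.Derives A t ∧ u = joinSep t) fun A α u hr hu => ?_
  obtain ⟨r, e⟩ := hr
  cases e
  obtain ⟨-, -, h3, h4, h5⟩ := (G.exists_term r.2).choose_spec
  obtain ⟨μ, hμ, rfl⟩ := DTerm.exists_value_of_valueIn_rename h3 hu
  choose ws h1 h2 using fun i => hμ i (h4 i)
  refine ⟨_, .rule r.1 r.2 ws h1, ?_⟩
  rw [← h5 ws fun i => (h1 i).length_eq]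
  exact congrArg (fun μ => DTerm.value μ _) (funext h2)

theorem language_toDCFG (G : WMCFG 2 T) : G.toDCFG.language = G.language := by
  ext w
  rw [DCFG.mem_language]
  constructor
  · intro h
    obtain ⟨t, ht, e⟩ := exists_derives_of_val h
    obtain ⟨w', rfl⟩ := List.length_eq_one_iff.1 (ht.length_eq.trans G.dim_start)
    obtain rfl := List.map_injective_iff.2 (Option.some_injective _) e
    exact ht
  · exact fun h => Derives.val h

end WMCFG

theorem IsWMCFL.isDCFL {T : Type} {L : Language T} (h : IsWMCFL 2 L) : IsDCFL 1 L := by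
  obtain ⟨G, rfl⟩ := h
  exact ⟨G.toDCFG, G.language_toDCFG⟩

theorem mainTheorem5 : ¬ IsDCFL 1 MIX ∧ ¬ IsWMCFL 2 MIX ∧ ¬ IsTAL MIX :=
  ⟨not_isDCFL_MIX, fun h => not_isDCFL_MIX h.isDCFL, fun h => not_isDCFL_MIX h.isDCFL⟩
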